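/- \textbf{Conventions.} An \emph{independence relation} on a category $\mathcal{C}$ is a class of commuting squares $$\begin{array}{ccc} A & \to & M\\ \uparrow & & \uparrow\\ C & \to & B\end{array}$$ called independent; one writes $A\perp_C^M B$ when the displayed square is independent. It satisfies \begin{itemize} \item \emph{invariance} if for every commuting square as above and every $M\to N$: $A\perp_C^M B$ iff $A\perp_C^N B$; \item \emph{semi-invariance} if for every commuting square as above and every $M\to N$: $A\perp_C^N B$ implies $A\perp_C^M B$; \item \emph{monotonicity} if $A\perp_C^M B$ and a factorisation $C\to B'\to B$ give $A\perp_C^M B'$; \item \emph{transitivity} if $A\perp_C^M B$ and $M\perp_B^N D$ give $A\perp_C^N D$; \item \emph{symmetry} if $A\perp_C^M B$ iff $B\perp_C^M A$; \item \emph{existence} if every span $A\leftarrow C\to B$ can be completed to an independent square; \item \emph{$3$-amalgamation} if for all $M\to A,B,C$ and independent squares $A\perp_M^{N_1}B$, $A\perp_M^{N_2}C$, $B\perp_M^{N_3}C$ there are an object $N$ and morphisms $N_1,N_2,N_3\to N$ making the resulting cube commute, with $A\perp_M^N N_3$; \item \emph{base monotonicity} if for all $A\perp_C^M D$ and every factorisation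 $C\to B\to D$ there are $A\to A'\leftarrow B$ and $A'\to N\leftarrow M$ such that everything commutes and $A'\perp_B^N D$. \end{itemize} Invariance and existence imply that every commuting square whose left or bottom morphism is an isomorphism is independent; so, with transitivity, the independent squares are the morphisms of a subcategory $\mathcal{C}_\perp$ of the arrow category $\mathcal{C}^2$ (containing all its objects), where the square above is viewed as a morphism from $C\to A$ to $B\to M$. The relation is \emph{simple} if it satisfies invariance, monotonicity, transitivity, symmetry, existence, $3$-amalgamation and base monotonicity, $\mathcal{C}_\perp$ is accessible, and $\mathcal{C}_\perp$ has directed colimits, which are preserved by the inclusion $\mathcal{C}_\perp\hookrightarrow\mathcal{C}^2$. A functor $F:\mathcal{C}\to\mathcal{D}$ is a \emph{left multiadjoint} if for every object $D$ of $\mathcal{D}$ there is a set-indexed family of morphisms $(e_i:F(C_i)\to D)_{i\in I}$ such that every $e:F(C)\to D$ is of the form $e=e_iF(f)$ for a unique $i\in I$ and a unique $f:C\to C_i$. A category is \emph{locally multipresentable} if it is accessible and every small diagram has a multicolimit, that is, a set of cocones such that each cocone on the diagram receives a morphism of cocones from exactly one member of the set, and only one such morphism. A \emph{factorisation system} $(\mathcal{E},\mathcal{M})$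 is an orthogonal one: both classes contain the isomorphisms and are closed under composition, every morphism factors as a member of $\mathcal{E}$ followed by a member of $\mathcal{M}$, and members of $\mathcal{E}$ have the unique left lifting property against members of $\mathcal{M}$. For a class $\mathcal{M}$ of morphisms of $\mathcal{D}$ that contains the isomorphisms and is closed under composition, $\mathcal{D}_\mathcal{M}$ is the subcategory of $\mathcal{D}$ with all objects and with the morphisms in $\mathcal{M}$; $\mathcal{M}$ is \emph{accessible} if $\mathcal{D}_\mathcal{M}$ is accessible, and \emph{continuous} if $\mathcal{D}_\mathcal{M}$ is closed under directed colimits in $\mathcal{D}$, that is, whenever a directed diagram in $\mathcal{D}_\mathcal{M}$ has a colimit in $\mathcal{D}$, the colimit cocone lies in $\mathcal{D}_\mathcal{M}$ and is a colimit cocone there. $F^{-1}$ denotes the preimage of a class of morphisms, and for an independence relation $\perp$ on $\mathcal{D}_\mathcal{M}$, $F^{-1}(\perp)$ is the independence relation on $\mathcal{C}_{F^{-1}(\mathcal{M})}$ consisting of the commuting squares whose image under $F$ is in $\perp$. \textbf{Theorem.} Let $F:\mathcal{C}\to\mathcal{D}$ be a faithful left multiadjoint between locally multipresentable categories, and let $(\mathcal{E},\mathcal{M})$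 be a factorisation system on $\mathcal{D}$ with $\mathcal{M}$ an accessible and continuous class of monomorphisms. Suppose that $(F^{-1}(\mathcal{E}),F^{-1}(\mathcal{M}))$ is a factorisation system on $\mathcal{C}$. If $\perp$ is a simple independence relation on $\mathcal{D}_\mathcal{M}$ which, regarded as an independence relation on $\mathcal{D}$ (with the same squares), satisfies semi-invariance, then $F^{-1}(\perp)$ is a simple independence relation on $\mathcal{C}_{F^{-1}(\mathcal{M})}$. -/

import Mathlib

open CategoryTheory CategoryTheory.Limits

universe w v v₁ v₂ u u₁ u₂

namespace CatIndep

/-! ### Directed colimits -/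

/-- The category has colimits of all diagrams indexed by small nonempty directed posets. -/
def HasDirectedColimits (C : Type u) [Category.{v} C] : Prop :=
  ∀ (J : Type w) [PartialOrder J] [IsDirectedOrder J] [Nonempty J], HasColimitsOfShape J C

/-- The functor preserves colimits of all diagrams indexed by small nonempty directed posets. -/
def PreservesDirectedColimits {C : Type u₁} [Category.{v₁} C] {D : Type u₂} [Category.{v₂} D]
    (F : C ⥤ D) : Prop :=
  ∀ (J : Type w) [PartialOrder J] [IsDirectedOrder J] [Nonempty J], PreservesColimitsOfShape J F

/-! ### Multicolimits, locally multipresentable categories, left multiadjoints -/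

/-- A family of cocones over `K` is a multicolimit of `K` if every cocone over `K` receives a
morphism of cocones from exactly one member of the family, and this morphism is unique. -/
def IsMulticolimit {C : Type u} [Category.{v} C] {J : Type w} [SmallCategory J] {K : J ⥤ C}
    {ι : Type w} (c : ι → Cocone K) : Prop :=
  ∀ s : Cocone K, ∃! p : (Σ i : ι, (c i).pt ⟶ s.pt), ∀ j : J, (c p.1).ι.app j ≫ p.2 = s.ι.app j

/-- Every small diagram has a multicolimit, consisting of a small set of cocones. -/
def IsMulticocomplete (C : Type u) [Category.{v} C] : Prop :=
  ∀ (J : Type w) [SmallCategory J] (K : J ⥤ C),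
    ∃ (ι : Type w) (c : ι → Cocone K), IsMulticolimit c

/-- A locally multipresentable category is a multicocomplete accessible category. -/
structure IsLocallyMultipresentable (C : Type u) [Category.{v} C] : Prop where
  accessible : IsAccessibleCategory.{w} C
  multicocomplete : IsMulticocomplete.{w} C

/-- `F` is a left multiadjoint: for every `d` there is a set-indexed family of morphisms
`e i : F (X i) ⟶ d` such that every `f : F c ⟶ d` equals `e i ∘ F g` for a unique `i`
and a unique `g : c ⟶ X i`. -/
def IsLeftMultiadjoint {C : Type u₁} [Category.{v₁} C] {D : Type u₂} [Category.{v₂} D]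
    (F : C ⥤ D) : Prop :=
  ∀ d : D, ∃ (ι : Type w) (X : ι → C) (e : ∀ i, F.obj (X i) ⟶ d),
    ∀ (c : C) (f : F.obj c ⟶ d), ∃! p : (Σ i : ι, c ⟶ X i), F.map p.2 ≫ e p.1 = f

/-! ### Classes of morphisms

For a class `M` of morphisms, closed under composition and containing the identities, the
category `C_M` is Mathlib's `WideSubcategory M`; the preimage of `M` under `F` is
`M.inverseImage F`. -/

/-- A factorisation system `(E, M)`: both classes are closed under composition and contain the
isomorphisms, every morphism is a member of `E` followed by a member of `M`, and members of `E`
have the unique left lifting property against members of `M`. -/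
structure IsFactorisationSystem {C : Type u} [Category.{v} C] (E M : MorphismProperty C) :
    Prop where
  left_iso : MorphismProperty.isomorphisms C ≤ E
  left_comp : ∀ {X Y Z : C} (f : X ⟶ Y) (g : Y ⟶ Z), E f → E g → E (f ≫ g)
  right_iso : MorphismProperty.isomorphisms C ≤ M
  right_comp : ∀ {X Y Z : C} (f : X ⟶ Y) (g : Y ⟶ Z), M f → M g → M (f ≫ g)
  factors : ∀ {X Y : C} (f : X ⟶ Y), ∃ (Z : C) (e : X ⟶ Z) (m : Z ⟶ Y), E e ∧ M m ∧ e ≫ m = f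
  lifts : ∀ {X Y Z W : C} (e : X ⟶ Y) (m : Z ⟶ W) (s : X ⟶ Z) (t : Y ⟶ W),
    E e → M m → s ≫ m = e ≫ t → ∃! d : Y ⟶ Z, e ≫ d = s ∧ d ≫ m = t

/-- `M` is an accessible class of morphisms of `C`: the category `C_M` is accessible. -/
def IsAccessibleClass {C : Type u} [Category.{v} C] (M : MorphismProperty C)
    [M.IsMultiplicative] : Prop :=
  IsAccessibleCategory.{w} (WideSubcategory M)

/-- `M` is a continuous class of morphisms of `C`: the subcategory `C_M` is closed under directed
colimits in `C`. That is, for a directed diagram in `C_M`, any colimit cocone in `C` has its legs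
in `M`, and the morphism it induces to any other cocone with legs in `M` is again in `M`. -/
def IsContinuousClass {C : Type u} [Category.{v} C] (M : MorphismProperty C)
    [M.IsMultiplicative] : Prop :=
  ∀ (J : Type w) [PartialOrder J] [IsDirectedOrder J] [Nonempty J]
    (K : J ⥤ WideSubcategory M) (c : Cocone (K ⋙ wideSubcategoryInclusion M)) (hc : IsColimit c),
    (∀ j, M (c.ι.app j)) ∧
      ∀ s : Cocone (K ⋙ wideSubcategoryInclusion M), (∀ j, M (s.ι.app j)) → M (hc.desc s)

/-- The restriction `C_{F⁻¹(M)} ⥤ D_M` of a functor `F : C ⥤ D`. -/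
def restrictFunctor {C : Type u₁} [Category.{v₁} C] {D : Type u₂} [Category.{v₂} D]
    (F : C ⥤ D) (M : MorphismProperty D) [M.IsMultiplicative] :
    WideSubcategory (M.inverseImage F) ⥤ WideSubcategory M where
  obj X := ⟨F.obj X.obj⟩
  map f := ⟨F.map f.hom, f.property⟩
  map_id X := WideSubcategory.hom_ext M (F.map_id X.obj)
  map_comp f g := WideSubcategory.hom_ext M (F.map_comp f.hom g.hom)

/-! ### Independence relations -/

/-- An independence relation on `C` is a class of commuting squares. For a square
```
  a --am--> m
  ^         ^
  ca        bm
  |         |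
  c --cb--> b
```
`Indep ca cb am bm` says that `a` is independent from `b` over `c` in `m`. -/
structure IndependenceRelation (C : Type u) [Category.{v} C] where
  Indep : ∀ {c a b m : C}, (c ⟶ a) → (c ⟶ b) → (a ⟶ m) → (b ⟶ m) → Prop
  comm : ∀ {c a b m : C} {ca : c ⟶ a} {cb : c ⟶ b} {am : a ⟶ m} {bm : b ⟶ m},
    Indep ca cb am bm → ca ≫ am = cb ≫ bm

namespace IndependenceRelation

variable {C : Type u} [Category.{v} C] (R : IndependenceRelation C)

/-- Independence of a commuting square in `m` and in an extension `n` of `m` are equivalent. -/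
def Invariance : Prop :=
  ∀ {c a b m n : C} (ca : c ⟶ a) (cb : c ⟶ b) (am : a ⟶ m) (bm : b ⟶ m) (mn : m ⟶ n),
    ca ≫ am = cb ≫ bm → (R.Indep ca cb am bm ↔ R.Indep ca cb (am ≫ mn) (bm ≫ mn))

/-- If `a` is independent from `b` over `c` in `m`, then so it is from any `b'` that factors
`c ⟶ b`. -/
def Monotonicity : Prop :=
  ∀ {c a b' b m : C} (ca : c ⟶ a) (cb' : c ⟶ b') (b'b : b' ⟶ b) (am : a ⟶ m) (bm : b ⟶ m),
    R.Indep ca (cb' ≫ b'b) am bm → R.Indep ca cb' am (b'b ≫ bm)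

/-- Horizontal composites of independent squares are independent. -/
def Transitivity : Prop :=
  ∀ {c a b m d n : C} (ca : c ⟶ a) (cb : c ⟶ b) (am : a ⟶ m) (bm : b ⟶ m)
    (bd : b ⟶ d) (mn : m ⟶ n) (dn : d ⟶ n),
    R.Indep ca cb am bm → R.Indep bm bd mn dn → R.Indep ca (cb ≫ bd) (am ≫ mn) dn

/-- `a` is independent from `b` over `c` in `m` iff `b` is independent from `a`. -/
def Symmetry : Prop :=
  ∀ {c a b m : C} (ca : c ⟶ a) (cb : c ⟶ b) (am : a ⟶ m) (bm : b ⟶ m),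
    R.Indep ca cb am bm ↔ R.Indep cb ca bm am

/-- Any commuting square whose bottom or left morphism is an isomorphism is independent. -/
def BasicExistence : Prop :=
  ∀ {c a b m : C} (ca : c ⟶ a) (cb : c ⟶ b) (am : a ⟶ m) (bm : b ⟶ m),
    ca ≫ am = cb ≫ bm → (IsIso cb ∨ IsIso ca) → R.Indep ca cb am bm

/-- Any span can be completed to an independent square. -/
def Existence : Prop :=
  ∀ {c a b : C} (ca : c ⟶ a) (cb : c ⟶ b),
    ∃ (m : C) (am : a ⟶ m) (bm : b ⟶ m), R.Indep ca cb am bm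

/-- If `a` is independent from `d` over `c` in `m` and `c ⟶ d` factors through `b`, then there are
`a'` under `a` and `b`, and an extension `n` of `m`, such that `a'` is independent from `d`
over `b` in `n`. -/
def BaseMonotonicity : Prop :=
  ∀ {c a b d m : C} (ca : c ⟶ a) (cb : c ⟶ b) (bd : b ⟶ d) (am : a ⟶ m) (dm : d ⟶ m),
    R.Indep ca (cb ≫ bd) am dm →
      ∃ (a' n : C) (aa' : a ⟶ a') (ba' : b ⟶ a') (a'n : a' ⟶ n) (mn : m ⟶ n),
        ca ≫ aa' = cb ≫ ba' ∧ aa' ≫ a'n = am ≫ mn ∧ ba' ≫ a'n = bd ≫ dm ≫ mn ∧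
          R.Indep ba' bd a'n (dm ≫ mn)

/-- `3`-amalgamation: an independent horn, consisting of `a, b, c` over `m` with independent
squares `a, b` in `n₁`, `a, c` in `n₂` and `b, c` in `n₃`, can be completed to a commuting cube
with vertex `n` in which `a` is independent from `n₃` over `m` in `n`. -/
def ThreeAmalgamation : Prop :=
  ∀ {m a b c n₁ n₂ n₃ : C} (ma : m ⟶ a) (mb : m ⟶ b) (mc : m ⟶ c)
    (an₁ : a ⟶ n₁) (bn₁ : b ⟶ n₁) (an₂ : a ⟶ n₂) (cn₂ : c ⟶ n₂) (bn₃ : b ⟶ n₃) (cn₃ : c ⟶ n₃),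
    R.Indep ma mb an₁ bn₁ → R.Indep ma mc an₂ cn₂ → R.Indep mb mc bn₃ cn₃ →
      ∃ (n : C) (n₁n : n₁ ⟶ n) (n₂n : n₂ ⟶ n) (n₃n : n₃ ⟶ n),
        an₁ ≫ n₁n = an₂ ≫ n₂n ∧ bn₁ ≫ n₁n = bn₃ ≫ n₃n ∧ cn₂ ≫ n₂n = cn₃ ≫ n₃n ∧
          R.Indep ma (mb ≫ bn₃) (an₁ ≫ n₁n) n₃n

/-- In a commuting diagram extending a square in `d` along `d ⟶ e`, if the outer square (in `e`)
is independent then so is the inner square (in `d`). -/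
def SemiInvariance : Prop :=
  ∀ {c a b d e : C} (ca : c ⟶ a) (cb : c ⟶ b) (ad : a ⟶ d) (bd : b ⟶ d) (de : d ⟶ e),
    ca ≫ ad = cb ≫ bd → R.Indep ca cb (ad ≫ de) (bd ≫ de) → R.Indep ca cb ad bd

/-- The independent squares, as a class of morphisms in the arrow category of `C`. -/
def squares : MorphismProperty (Arrow C) :=
  fun X Y φ => R.Indep X.hom φ.left φ.right Y.hom

variable {R}

theorem isMultiplicative_squares (h₁ : R.BasicExistence) (h₂ : R.Transitivity) :
    R.squares.IsMultiplicative where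
  id_mem X := h₁ _ _ _ _ (by simp) (Or.inl (by rw [Arrow.id_left]; infer_instance))
  comp_mem φ ψ hφ hψ := by
    have := h₂ _ _ _ _ _ _ _ hφ hψ
    simpa [squares] using this

theorem Existence.basicExistence (h₁ : R.Existence) (h₂ : R.Invariance) : R.BasicExistence := by
  intro c a b m ca cb am bm hw hiso
  rcases hiso with h | h
  · obtain ⟨n, p, q, hn⟩ := h₁ ca cb
    have e : (inv cb ≫ ca) ≫ p = q := by rw [Category.assoc, R.comm hn]; simp
    have e' : (inv cb ≫ ca) ≫ am = bm := by rw [Category.assoc, hw]; simp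
    have hi : R.Indep ca cb (𝟙 a) (inv cb ≫ ca) := by
      rw [h₂ ca cb (𝟙 a) (inv cb ≫ ca) p (by simp), e, Category.id_comp]
      exact hn
    rw [h₂ ca cb (𝟙 a) (inv cb ≫ ca) am (by simp), e', Category.id_comp] at hi
    exact hi
  · obtain ⟨n, p, q, hn⟩ := h₁ ca cb
    have e : (inv ca ≫ cb) ≫ q = p := by rw [Category.assoc, ← R.comm hn]; simp
    have e' : (inv ca ≫ cb) ≫ bm = am := by rw [Category.assoc, ← hw]; simp
    have hi : R.Indep ca cb (inv ca ≫ cb) (𝟙 b) := by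
      rw [h₂ ca cb (inv ca ≫ cb) (𝟙 b) q (by simp), e, Category.id_comp]
      exact hn
    rw [h₂ ca cb (inv ca ≫ cb) (𝟙 b) bm (by simp), e', Category.id_comp] at hi
    exact hi

variable (R)

/-- The category whose objects are the morphisms of `C` and whose morphisms are the independent
squares; it is formed for a relation satisfying basic existence and transitivity. -/
abbrev IndepArrow (h₁ : R.BasicExistence) (h₂ : R.Transitivity) :=
  @WideSubcategory (Arrow C) _ R.squares (isMultiplicative_squares h₁ h₂)

/-- The inclusion of the category of independent squares in the category of all squares. -/
abbrev indepArrowInclusion (h₁ : R.BasicExistence) (h₂ : R.Transitivity) :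
    R.IndepArrow h₁ h₂ ⥤ Arrow C :=
  @wideSubcategoryInclusion (Arrow C) _ R.squares (isMultiplicative_squares h₁ h₂)

/-- The relation is accessible: the category of independent squares is accessible. -/
def Accessible (h₁ : R.BasicExistence) (h₂ : R.Transitivity) : Prop :=
  IsAccessibleCategory.{w} (R.IndepArrow h₁ h₂)

/-- The category of independent squares has directed colimits, and these are preserved by the
inclusion in the category of all squares. -/
def Union (h₁ : R.BasicExistence) (h₂ : R.Transitivity) : Prop :=
  HasDirectedColimits.{w} (R.IndepArrow h₁ h₂) ∧
    PreservesDirectedColimits.{w} (R.indepArrowInclusion h₁ h₂)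

/-- NSOP₁-like independence relations. -/
structure IsNSOP1Like : Prop where
  invariance : R.Invariance
  monotonicity : R.Monotonicity
  transitivity : R.Transitivity
  symmetry : R.Symmetry
  existence : R.Existence
  threeAmalgamation : R.ThreeAmalgamation
  accessible : Accessible.{w} R (existence.basicExistence invariance) transitivity
  union : Union.{w} R (existence.basicExistence invariance) transitivity

/-- Simple independence relations. -/
structure IsSimple : Prop extends IsNSOP1Like.{w} R where
  baseMonotonicity : R.BaseMonotonicity

/-- The lift of an independence relation on `D` along a functor `F : C ⥤ D`: a commuting square
in `C` is independent iff its image in `D` is. -/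
def lift {C : Type u₁} [Category.{v₁} C] {D : Type u₂} [Category.{v₂} D]
    (R : IndependenceRelation D) (F : C ⥤ D) : IndependenceRelation C where
  Indep ca cb am bm :=
    ca ≫ am = cb ≫ bm ∧ R.Indep (F.map ca) (F.map cb) (F.map am) (F.map bm)
  comm h := h.1

/-- An independence relation on `C_M`, viewed as an independence relation on `C` with the same
class of squares. -/
def toAmbient {M : MorphismProperty C} [M.IsMultiplicative]
    (R : IndependenceRelation (WideSubcategory M)) : IndependenceRelation C where
  Indep {c a b m} ca cb am bm :=
    ∃ (hca : M ca) (hcb : M cb) (ham : M am) (hbm : M bm),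
      R.Indep (c := ⟨c⟩) (a := ⟨a⟩) (b := ⟨b⟩) (m := ⟨m⟩) ⟨ca, hca⟩ ⟨cb, hcb⟩ ⟨am, ham⟩ ⟨bm, hbm⟩
  comm h := by
    obtain ⟨_, _, _, _, h⟩ := h
    exact congrArg InducedWideCategory.Hom.hom (R.comm h)

end IndependenceRelation

end CatIndep

/-! Invariance, monotonicity, transitivity and symmetry pass to preimages under any functor. The
other axioms need three ideas.

Amalgams are built in `D_M` and pulled back to `C`. If `N` completes the image of a span or horn,
the legs factor through one member `e : F X ⟶ N` of the multicoreflection of `N`, because the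
diagram is connected. Semi-invariance says that the square is still independent in `F X`, although
`e` need not lie in `M`; it also makes `M` left cancellable (`SemiInvariance.left_cancel`), so the
legs into `F X` lie in `M`. This gives existence and 3-amalgamation. For base monotonicity, take a
local pushout `P` of `a` and `b` over `c` inside `m`, and let `I` be the image of `P ⟶ m` for the
preimage factorisation system. A diagonal fill-in maps `F I` into the object `A` supplied by base
monotonicity in `D_M`. Symmetry, monotonicity and invariance then make `I` independent from `d` over
`b` in `m`.

`C_{F⁻¹(M)}` has directed colimits, preserved by the restriction of `F`
(`exists_isColimit_restrictFunctor`): coreflecting the colimit taken in `D_M` gives a cocone in `C`,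
and a local colimit above it has the right image. This category is accessible
(`restrict_isAccessible`) because the `E`-quotients of `κ`-presentable objects are essentially small
and generate.

The category of independent squares of the lift is the preimage of that of `R` under a functor of
arrow categories. All morphisms involved are monomorphisms, so accessibility means that small
subobjects abound, and a Löwenheim–Skolem chain provides them (`wide_pullback_isAccessible`). -/

namespace CatIndep

/-! ### Filtered colimits from directed colimits -/

theorem HasDirectedColimits.hasFilteredColimits {K : Type u} [Category.{v} K]
    (h : HasDirectedColimits.{w} K) : HasFilteredColimitsOfSize.{w, w} K where
  HasColimitsOfShape J _ _ := by
    obtain ⟨α, _, _, _, F, _⟩ := IsFiltered.exists_directed J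
    have := h α
    exact Functor.Final.hasColimitsOfShape_of_final F

theorem PreservesDirectedColimits.preservesFilteredColimits {K : Type u₁} [Category.{v₁} K]
    {L : Type u₂} [Category.{v₂} L] {F : K ⥤ L} (h : PreservesDirectedColimits.{w} F) :
    PreservesFilteredColimitsOfSize.{w, w} F where
  preserves_filtered_colimits J _ _ := by
    obtain ⟨α, _, _, _, G, _⟩ := IsFiltered.exists_directed J
    have := h α
    exact Functor.Final.preservesColimitsOfShape_of_final G F

theorem hasDirectedColimits_of_hasFilteredColimits (K : Type u) [Category.{v} K]
    [HasFilteredColimitsOfSize.{w, w} K] : HasDirectedColimits.{w} K := by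
  intro J _ _ _
  infer_instance

theorem preservesDirectedColimits_of_preservesFilteredColimits {K : Type u₁} [Category.{v₁} K]
    {L : Type u₂} [Category.{v₂} L] (F : K ⥤ L) [PreservesFilteredColimitsOfSize.{w, w} F] :
    PreservesDirectedColimits.{w} F := by
  intro J _ _ _
  exact PreservesFilteredColimitsOfSize.preserves_filtered_colimits J

theorem hasCardinalFilteredColimits (K : Type u) [Category.{v} K]
    [HasFilteredColimitsOfSize.{w, w} K] (κ : Cardinal.{w}) [Fact κ.IsRegular] :
    HasCardinalFilteredColimits.{w} K κ where
  hasColimitsOfShape J _ _ := by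
    have := isFiltered_of_isCardinalFiltered J κ
    infer_instance

/-! ### Categories of monomorphisms -/

/-- All morphisms of the category are monomorphisms. -/
class AllMono (K : Type u) [Category.{v} K] : Prop where
  mono : ∀ {X Y : K} (f : X ⟶ Y), Mono f

theorem AllMono.of_faithful {K : Type u₁} [Category.{v₁} K] {L : Type u₂} [Category.{v₂} L]
    (F : K ⥤ L) [F.Faithful] (h : ∀ {X Y : K} (f : X ⟶ Y), Mono (F.map f)) : AllMono K where
  mono f := by
    have := h f
    exact F.mono_of_mono_map this

section

variable {K : Type u} [Category.{v} K]

theorem isCardinalAccessible_of_generator [LocallySmall.{w} K]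
    [HasFilteredColimitsOfSize.{w, w} K] {κ : Cardinal.{w}} [Fact κ.IsRegular]
    {P : ObjectProperty K} [ObjectProperty.EssentiallySmall.{w} P]
    (hP : P.IsCardinalFilteredGenerator κ) : IsCardinalAccessibleCategory K κ := by
  have := hasCardinalFilteredColimits K κ
  have := hP.hasCardinalFilteredGenerator
  exact {}

/-- If a colimit is mapped to `X` by `v` and all its components factor through the
monomorphism `u : Y ⟶ X`, then so does `v`. -/
theorem exists_lift_of_isColimit {J : Type u₁} [Category.{v₁} J] {F : J ⥤ K}
    {c : Cocone F} (hc : IsColimit c) {X Y : K} (v : c.pt ⟶ X) (u : Y ⟶ X) [Mono u]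
    (h : ∀ j, ∃ f : F.obj j ⟶ Y, f ≫ u = c.ι.app j ≫ v) : ∃ f : c.pt ⟶ Y, f ≫ u = v := by
  choose f hf using h
  refine ⟨hc.desc ⟨Y, { app := f, naturality := ?_ }⟩, hc.hom_ext fun j => ?_⟩
  · intro i j a
    rw [← cancel_mono u]
    simp [hf]
  · simp [hf]

variable [AllMono K]

theorem AllMono.cancel {X Y Z : K} {f g : X ⟶ Y} (h : Y ⟶ Z) (w : f ≫ h = g ≫ h) : f = g :=
  (AllMono.mono h).right_cancellation _ _ w

theorem AllMono.isIso_of_section {X Y : K} (f : X ⟶ Y) (s : Y ⟶ X) (h : s ≫ f = 𝟙 Y) : IsIso f :=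
  ⟨s, AllMono.cancel f (by simp [h]), h⟩

theorem AllMono.exists_lift_of_isColimit {J : Type u₁} [Category.{v₁} J] {F : J ⥤ K}
    {c : Cocone F} (hc : IsColimit c) {X Y : K} (v : c.pt ⟶ X) (u : Y ⟶ X)
    (h : ∀ j, ∃ f : F.obj j ⟶ Y, f ≫ u = c.ι.app j ≫ v) : ∃ f : c.pt ⟶ Y, f ≫ u = v :=
  have := AllMono.mono u
  CatIndep.exists_lift_of_isColimit hc v u h

/-- In a category of monomorphisms, `X` is presentable if maps to filtered colimits factor
through the diagram. -/
theorem AllMono.isCardinalPresentable_of_lift (X : K) (κ : Cardinal.{w}) [Fact κ.IsRegular]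
    (h : ∀ (J : Type w) [SmallCategory J] [IsCardinalFiltered J κ] (F : J ⥤ K) (c : Cocone F)
      (_ : IsColimit c) (f : X ⟶ c.pt), ∃ (j : J) (g : X ⟶ F.obj j), g ≫ c.ι.app j = f) :
    IsCardinalPresentable X κ where
  preservesColimitOfShape J _ _ := ⟨fun {F} => ⟨fun {c} hc => by
    have := isFiltered_of_isCardinalFiltered J κ
    refine ⟨Types.FilteredColimit.isColimitOf' _ _ ?_ ?_⟩
    · intro f
      obtain ⟨j, g, hg⟩ := h J F c hc f
      exact ⟨j, g, hg.symm⟩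
    -- The uniqueness half of presentability is automatic, since colimit legs are monic.
    · intro j f g hfg
      have hfg' : (f : X ⟶ F.obj j) = g := AllMono.cancel (K := K) (c.ι.app j) hfg
      exact ⟨j, 𝟙 j, by rw [hfg']⟩⟩⟩

/-- Criterion for the accessibility of a category of monomorphisms: every object is the directed
union of its small subobjects. -/
theorem AllMono.isCardinalFilteredGenerator_of_subobjects [LocallySmall.{w} K]
    [HasFilteredColimitsOfSize.{w, w} K] (κ : Cardinal.{w}) [Fact κ.IsRegular]
    (P : ObjectProperty K) [ObjectProperty.EssentiallySmall.{w} P]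
    (hP : P ≤ isCardinalPresentable K κ)
    (h₁ : ∀ (X : K) (ι : Type w) (_ : HasCardinalLT ι κ) (p : ι → K) (_ : ∀ i, P (p i))
      (f : ∀ i, p i ⟶ X), ∃ (q : K) (_ : P q) (g : q ⟶ X), ∀ i, ∃ a : p i ⟶ q, a ≫ g = f i)
    (h₂ : ∀ (Z X : K) (m : Z ⟶ X),
      (∀ (p : K) (_ : P p) (f : p ⟶ X), ∃ a : p ⟶ Z, a ≫ m = f) → IsIso m) :
    P.IsCardinalFilteredGenerator κ := by
  have hfc := hasCardinalFilteredColimits K κ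
  refine ⟨hP, fun X => ?_⟩
  -- The comma category is thin because structure maps to `X` are monic, so filteredness reduces to
  -- upper bounds.
  have hthin : ∀ {A B : CostructuredArrow P.ι X} (f g : A ⟶ B), f = g := by
    intro A B f g
    ext
    apply AllMono.cancel B.hom
    exact (CostructuredArrow.w f).trans (CostructuredArrow.w g).symm
  have hfil : IsCardinalFiltered (CostructuredArrow P.ι X) κ := by
    rw [isCardinalFiltered_iff]
    constructor
    · intro ι j hι
      obtain ⟨q, hq, g, hg⟩ := h₁ X ι hι (fun i => (j i).left.obj) (fun i => (j i).left.property)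
        (fun i => (j i).hom)
      refine ⟨CostructuredArrow.mk (Y := ⟨q, hq⟩) (by exact g), fun i => ?_⟩
      obtain ⟨a, ha⟩ := hg i
      exact ⟨CostructuredArrow.homMk (ObjectProperty.homMk a) ha⟩
    · intro ι j k f hι
      by_cases hne : Nonempty ι
      · exact ⟨k, 𝟙 k, f hne.some, fun i => hthin _ _⟩
      -- For an empty family of parallel arrows no arrow `j ⟶ k` is available, and an upper bound of
      -- the pair is needed.
      · obtain ⟨q, hq, g, hg⟩ := h₁ X (ULift.{w} Bool)
          (hasCardinalLT_of_finite _ _ (Cardinal.IsRegular.aleph0_le Fact.out))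
          (fun i => bif i.down then k.left.obj else j.left.obj)
          (by rintro ⟨_ | _⟩; exacts [j.left.property, k.left.property])
          (by rintro ⟨_ | _⟩; exacts [j.hom, k.hom])
        obtain ⟨a, ha⟩ : ∃ a : k.left.obj ⟶ q, a ≫ g = k.hom := hg ⟨true⟩
        obtain ⟨b, hb⟩ : ∃ b : j.left.obj ⟶ q, b ≫ g = j.hom := hg ⟨false⟩
        let B : CostructuredArrow P.ι X := CostructuredArrow.mk (Y := ⟨q, hq⟩) (by exact g)
        exact ⟨B,
          CostructuredArrow.homMk (ObjectProperty.homMk a) ha,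
          CostructuredArrow.homMk (ObjectProperty.homMk b) hb, fun i => (hne ⟨i⟩).elim⟩
  let e := equivSmallModel.{w} (CostructuredArrow P.ι X)
  have hfil' := IsCardinalFiltered.of_equivalence κ e
  let F : SmallModel.{w} (CostructuredArrow P.ι X) ⥤ K :=
    e.inverse ⋙ CostructuredArrow.proj P.ι X ⋙ P.ι
  let c : Cocone F :=
    { pt := X
      ι :=
        { app := fun j => (e.inverse.obj j).hom
          naturality := fun i j f =>
            (CostructuredArrow.w (e.inverse.map f)).trans (Category.comp_id _).symm } }
  have := hfc.hasColimitsOfShape (SmallModel.{w} (CostructuredArrow P.ι X))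
  have hiso : IsIso ((colimit.isColimit F).desc c) := by
    apply h₂
    intro p hp f
    let A : CostructuredArrow P.ι X := CostructuredArrow.mk (Y := ⟨p, hp⟩) (by exact f)
    let i := (e.unitIso.app A).hom
    refine ⟨i.left.hom ≫ colimit.ι F (e.functor.obj A), ?_⟩
    refine (Category.assoc _ _ _).trans ?_
    refine (congrArg (i.left.hom ≫ ·) ((colimit.isColimit F).fac c (e.functor.obj A))).trans ?_
    exact CostructuredArrow.w i
  refine ⟨SmallModel.{w} (CostructuredArrow P.ι X), inferInstance, hfil', ⟨?_⟩⟩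
  exact
    { diag := F
      ι := c.ι
      isColimit := (colimit.isColimit F).ofPointIso (t := c)
      prop_diag_obj := fun j => (e.inverse.obj j).left.property }

end

/-! ### Presentable subobjects in accessible categories -/

section

variable {K : Type u} [Category.{v} K] {κ : Cardinal.{w}} [Fact κ.IsRegular]

theorem exists_colimitOfShape_presentable (κ : Cardinal.{w}) [Fact κ.IsRegular]
    [IsCardinalAccessibleCategory K κ] (X : K) :
    ∃ (J : Type w) (_ : SmallCategory J) (_ : IsCardinalFiltered J κ),
      Nonempty ((isCardinalPresentable K κ).ColimitOfShape J X) := by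
  obtain ⟨P, _, hP⟩ := HasCardinalFilteredGenerator.exists_generator K κ
  obtain ⟨J, _, _, ⟨p⟩⟩ := hP.exists_colimitsOfShape X
  exact ⟨J, inferInstance, inferInstance, ⟨p.ofLE hP.le_isCardinalPresentable⟩⟩

theorem exists_presentable_bound [IsCardinalAccessibleCategory K κ] {X : K} {ι : Type w}
    (hι : HasCardinalLT ι κ) {p : ι → K} (hp : ∀ i, IsCardinalPresentable (p i) κ)
    (f : ∀ i, p i ⟶ X) :
    ∃ (q : K) (_ : IsCardinalPresentable q κ) (g : q ⟶ X), ∀ i, ∃ a : p i ⟶ q, a ≫ g = f i := by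
  obtain ⟨J, _, _, ⟨c⟩⟩ := exists_colimitOfShape_presentable κ X
  have h (i : ι) : ∃ (j : J) (g : p i ⟶ c.diag.obj j), g ≫ c.ι.app j = f i :=
    IsCardinalPresentable.exists_hom_of_isColimit κ c.isColimit (f i)
  choose j g hg using h
  refine ⟨c.diag.obj (IsCardinalFiltered.max j hι), c.prop_diag_obj _, c.ι.app _, fun i =>
    ⟨g i ≫ c.diag.map (IsCardinalFiltered.toMax j hι i), ?_⟩⟩
  have := c.w (IsCardinalFiltered.toMax j hι i)
  rw [Category.assoc, this, hg]

theorem exists_presentable_lift_map [IsCardinalAccessibleCategory K κ] {L : Type u₁}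
    [Category.{v₁} L] (G : K ⥤ L) [G.IsCardinalAccessible κ] {t : L} [IsCardinalPresentable t κ]
    {X : K} (f : t ⟶ G.obj X) :
    ∃ (q : K) (_ : IsCardinalPresentable q κ) (g : q ⟶ X) (a : t ⟶ G.obj q),
      a ≫ G.map g = f := by
  obtain ⟨J, _, _, ⟨c⟩⟩ := exists_colimitOfShape_presentable κ X
  have := G.preservesColimitsOfShape_of_isCardinalAccessible κ J
  obtain ⟨j, a, ha⟩ :=
    IsCardinalPresentable.exists_hom_of_isColimit κ (isColimitOfPreserves G c.isColimit) f
  exact ⟨c.diag.obj j, c.prop_diag_obj _, c.ι.app j, a, ha⟩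

/-- `X` is a colimit of presentable objects, so the identity of `X` factors through `m`; a
monomorphism with a section is invertible. -/
theorem AllMono.isIso_of_forall_presentable [AllMono K] [IsCardinalAccessibleCategory K κ]
    {Z X : K} (m : Z ⟶ X)
    (h : ∀ (p : K) (_ : IsCardinalPresentable p κ) (f : p ⟶ X), ∃ a : p ⟶ Z, a ≫ m = f) :
    IsIso m := by
  obtain ⟨J, _, _, ⟨c⟩⟩ := exists_colimitOfShape_presentable κ X
  obtain ⟨s, hs⟩ := AllMono.exists_lift_of_isColimit c.isColimit (𝟙 X) m (fun j => by
    obtain ⟨a, ha⟩ := h _ (c.prop_diag_obj j) (c.ι.app j)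
    exact ⟨a, ha.trans (Category.comp_id _).symm⟩)
  exact AllMono.isIso_of_section m s hs

end

/-! ### Raising the index of accessibility -/

theorem hasCardinalLT_arrow_of_preorder {J : Type u} [Preorder J] {κ : Cardinal.{w}}
    [Fact κ.IsRegular] (h : HasCardinalLT J κ) : HasCardinalLT (Arrow J) κ := by
  refine (hasCardinalLT_prod (Cardinal.IsRegular.aleph0_le Fact.out) h h).of_injective
    (fun f : Arrow J => (f.left, f.right)) ?_
  rintro ⟨a, b, f⟩ ⟨a', b', f'⟩ h
  obtain ⟨rfl, rfl⟩ := Prod.mk.inj h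
  obtain rfl : f = f' := Subsingleton.elim _ _
  rfl

/-- Close the set under chosen upper bounds `ω` times. Strictness of `ℵ₀ < κ` keeps the countable
union `κ`-small; the extra point `x₀` ensures nonemptiness. -/
theorem exists_directed_superset {α : Type w} [PartialOrder α] [IsDirectedOrder α] [Nonempty α]
    {κ : Cardinal.{w}} [Fact κ.IsRegular] (hκ : Cardinal.aleph0 < κ) {S : Set α}
    (hS : HasCardinalLT S κ) :
    ∃ T : Set α, S ⊆ T ∧ Nonempty T ∧ IsDirectedOrder T ∧ HasCardinalLT T κ := by
  choose ub hub using fun p : α × α => exists_ge_ge p.1 p.2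
  let x₀ : α := Classical.arbitrary α
  let T : ℕ → Set α := fun n =>
    Nat.rec (motive := fun _ => Set α) (S ∪ {x₀}) (fun _ A => A ∪ ub '' (A ×ˢ A)) n
  have hT : ∀ n, T (n + 1) = T n ∪ ub '' (T n ×ˢ T n) := fun n => rfl
  have hmono : Monotone T := monotone_nat_of_le_succ fun n => by
    rw [hT]
    exact Set.subset_union_left
  have hx₀ : x₀ ∈ T 0 := Or.inr rfl
  refine ⟨⋃ n, T n, fun x hx => Set.mem_iUnion.2 ⟨0, Or.inl hx⟩,
    ⟨⟨x₀, Set.mem_iUnion.2 ⟨0, hx₀⟩⟩⟩, ⟨?_⟩, ?_⟩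
  · rintro ⟨x, hx⟩ ⟨y, hy⟩
    obtain ⟨m, hm⟩ := Set.mem_iUnion.1 hx
    obtain ⟨n, hn⟩ := Set.mem_iUnion.1 hy
    have hm' := hmono (le_max_left m n) hm
    have hn' := hmono (le_max_right m n) hn
    refine ⟨⟨ub (x, y), Set.mem_iUnion.2 ⟨max m n + 1, Or.inr ⟨(x, y), ⟨hm', hn'⟩, rfl⟩⟩⟩, ?_, ?_⟩
    · exact (hub (x, y)).1
    · exact (hub (x, y)).2
  · refine hasCardinalLT_iUnion _ ?_ fun n => ?_
    · rw [HasCardinalLT]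
      simpa using hκ
    · have hle := Cardinal.IsRegular.aleph0_le (Fact.out : κ.IsRegular)
      induction n with
      | zero => exact hasCardinalLT_union hle hS (hasCardinalLT_of_finite _ _ hle)
      | succ n ih =>
        rw [hT]
        refine hasCardinalLT_union hle ih ?_
        refine (hasCardinalLT_prod hle ih ih).of_surjective
          (fun p : T n × T n => ⟨ub (p.1.1, p.2.1), (p.1.1, p.2.1), ⟨p.1.2, p.2.2⟩, rfl⟩) ?_
        rintro ⟨_, ⟨x, y⟩, ⟨hx, hy⟩, rfl⟩
        exact ⟨(⟨x, hx⟩, ⟨y, hy⟩), rfl⟩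

section

variable {K : Type u} [Category.{v} K]

/-- Colimits of diagrams of objects in `P`, indexed by directed posets of cardinality `< κ`. -/
def directedColimits (P : ObjectProperty K) (κ : Cardinal.{w}) : ObjectProperty K := fun X =>
  ∃ (J : Type w) (_ : PartialOrder J) (_ : IsDirectedOrder J) (_ : Nonempty J),
    HasCardinalLT J κ ∧ P.colimitsOfShape J X

theorem directedColimits_le_colimitsCardinalClosure (P : ObjectProperty K) (κ : Cardinal.{w})
    [Fact κ.IsRegular] : directedColimits P κ ≤ P.colimitsCardinalClosure κ := by
  rintro X ⟨J, _, _, _, hJ, ⟨p⟩⟩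
  have := P.isClosedUnderColimitsOfShape_colimitsCardinalClosure κ J
    (hasCardinalLT_arrow_of_preorder hJ)
  exact (p.ofLE (P.le_colimitsCardinalClosure κ)).prop

theorem le_directedColimits (P : ObjectProperty K) (κ : Cardinal.{w}) [Fact κ.IsRegular] :
    P ≤ directedColimits P κ := by
  intro X hX
  refine ⟨PUnit, inferInstance, inferInstance, inferInstance,
    hasCardinalLT_of_finite _ _ (Cardinal.IsRegular.aleph0_le Fact.out), ⟨?_⟩⟩
  exact
    { diag := (Functor.const _).obj X
      ι := { app := fun _ => 𝟙 X }
      isColimit :=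
        { desc := fun s => s.ι.app PUnit.unit
          fac := fun s j => by simp
          uniq := fun s m hm => by simpa using hm PUnit.unit }
      prop_diag_obj := fun _ => hX }

theorem directedColimits_presentable_le [LocallySmall.{w} K] {κ κ' : Cardinal.{w}}
    [Fact κ.IsRegular] [Fact κ'.IsRegular] (h : κ ≤ κ') :
    directedColimits (isCardinalPresentable K κ) κ' ≤ isCardinalPresentable K κ' := by
  rintro X ⟨J, _, _, _, hJ, ⟨p⟩⟩
  exact p.isCardinalPresentable le_rfl κ' h (hasCardinalLT_arrow_of_preorder hJ)

variable [AllMono K] [HasFilteredColimitsOfSize.{w, w} K]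

/-- A category of monomorphisms with directed colimits which is `κ`-accessible is `κ'`-accessible
for all regular `κ' ≥ κ`, and its `κ'`-presentable objects are `κ'`-small directed colimits of
`κ`-presentable ones. -/
theorem AllMono.isCardinalAccessible_of_le {κ κ' : Cardinal.{w}} [Fact κ.IsRegular]
    [Fact κ'.IsRegular] (h : κ ≤ κ') [IsCardinalAccessibleCategory K κ] :
    IsCardinalAccessibleCategory K κ' ∧
      isCardinalPresentable K κ' ≤ directedColimits (isCardinalPresentable K κ) κ' := by
  obtain rfl | hlt := h.eq_or_lt
  · exact ⟨inferInstance, le_directedColimits _ _⟩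
  have hκ' : Cardinal.aleph0 < κ' :=
    (Cardinal.IsRegular.aleph0_le (Fact.out : κ.IsRegular)).trans_lt hlt
  have hsmall : ObjectProperty.EssentiallySmall.{w}
      (directedColimits (isCardinalPresentable K κ) κ') :=
    .of_le (directedColimits_le_colimitsCardinalClosure _ _)
  have key : (directedColimits (isCardinalPresentable K κ) κ').IsCardinalFilteredGenerator κ' := by
    refine AllMono.isCardinalFilteredGenerator_of_subobjects κ'
      (directedColimits (isCardinalPresentable K κ) κ') (directedColimits_presentable_le h) ?_ ?_
    · intro X ι hι p hp f
      obtain ⟨J, _, _, ⟨c₀⟩⟩ := exists_colimitOfShape_presentable κ X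
      obtain ⟨α, _, _, G, _⟩ := IsCardinalFiltered.exists_cardinal_directed J κ
      let c := c₀.reindex G
      have := isFiltered_of_isCardinalFiltered α κ
      have hdir : IsDirectedOrder α := ⟨fun a b =>
        ⟨IsFiltered.max a b, leOfHom (IsFiltered.leftToMax a b),
          leOfHom (IsFiltered.rightToMax a b)⟩⟩
      have hne : Nonempty α := IsFiltered.nonempty
      -- `p i` is a `κ'`-small colimit of `κ`-presentable objects, each landing in some stage of
      -- `c`. `S` collects these stages, so a subobject containing them contains `p i`.
      have hf (i : ι) : ∃ S : Set α, HasCardinalLT S κ' ∧ ∀ (q : K) (g : q ⟶ X),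
          (∀ a ∈ S, ∃ b : c.diag.obj a ⟶ q, b ≫ g = c.ι.app a) → ∃ b : p i ⟶ q, b ≫ g = f i := by
        obtain ⟨I, _, _, _, hI, ⟨d⟩⟩ := hp i
        have hd (k : I) : ∃ (j : α) (g : d.diag.obj k ⟶ c.diag.obj j),
            g ≫ c.ι.app j = d.ι.app k ≫ f i :=
          have : IsCardinalPresentable (d.diag.obj k) κ := d.prop_diag_obj k
          IsCardinalPresentable.exists_hom_of_isColimit κ c.isColimit _
        choose j g hg using hd
        refine ⟨Set.range j, hI.of_surjective _ Set.rangeFactorization_surjective, ?_⟩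
        intro q t ht
        refine AllMono.exists_lift_of_isColimit d.isColimit (f i) t fun k => ?_
        obtain ⟨b, hb⟩ := ht (j k) ⟨k, rfl⟩
        refine ⟨g k ≫ b, ?_⟩
        rw [Category.assoc, hb]
        exact hg k
      choose S hS hS' using hf
      -- All directed colimits exist, so `T` need only be directed, not `κ`-directed. This is why `κ
      -- ≤ κ'` suffices and no sharp inequality of cardinals is needed.
      obtain ⟨T, hST, _, _, hT⟩ := exists_directed_superset hκ' (hasCardinalLT_iUnion S hι hS)
      let G₀ : T ⥤ α := { obj := fun t => t.1, map := fun f => homOfLE (leOfHom f) }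
      let F : T ⥤ K := G₀ ⋙ c.diag
      let s : Cocone F :=
        { pt := X
          ι :=
            { app := fun t => c.ι.app t.1
              naturality := fun a b f => c.ι.naturality (G₀.map f) } }
      refine ⟨colimit F, ⟨T, inferInstance, inferInstance, inferInstance, hT, ⟨?_⟩⟩,
        colimit.desc F s, fun i => hS' i _ _ fun a ha => ?_⟩
      · exact ObjectProperty.ColimitOfShape.colimit F fun t => c.prop_diag_obj _
      · exact ⟨colimit.ι F ⟨a, hST (Set.mem_iUnion.2 ⟨i, ha⟩)⟩, colimit.ι_desc s _⟩
    · intro Z X m hm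
      exact AllMono.isIso_of_forall_presentable (κ := κ) m fun p hp f =>
        hm p (le_directedColimits _ _ _ hp) f
  refine ⟨isCardinalAccessible_of_generator key, fun X hX => ?_⟩
  -- Presentable objects are retracts of generators, and retractions between monomorphisms are
  -- isomorphisms.
  rw [key.isPresentable_eq_retractClosure] at hX
  obtain ⟨Y, ⟨J, _, _, _, hJ, ⟨c⟩⟩, ⟨r⟩⟩ := hX
  have : IsIso r.r := AllMono.isIso_of_section r.r r.i r.retract
  exact ⟨J, inferInstance, inferInstance, inferInstance, hJ, ⟨c.ofIso (asIso r.r)⟩⟩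

end

theorem essentiallySmall_of_family {K : Type u} [Category.{v} K] {P : ObjectProperty K}
    {T : Type u₁} [Small.{w} T] (F : T → K) (h : ∀ X, P X → ∃ t, Nonempty (X ≅ F t)) :
    ObjectProperty.EssentiallySmall.{w} P where
  exists_small_le' := ⟨.ofObj F, inferInstance, fun X hX => by
    obtain ⟨t, ht⟩ := h X hX
    exact ⟨F t, ⟨t⟩, ht⟩⟩

/-! ### Functors preserving presentable objects -/

theorem exists_regular_bound {T : Type u} [Small.{w} T] (κ : T → Cardinal.{w}) :
    ∃ μ : Cardinal.{w}, μ.IsRegular ∧ ∀ t, κ t ≤ μ := by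
  obtain ⟨μ, h₁, h₂⟩ := HasCardinalLT.exists_regular_cardinal_forall.{w}
    fun t : T => (κ t).ord.ToType
  exact ⟨μ, h₁, fun t => le_of_lt (by simpa [hasCardinalLT_iff_cardinal_mk_lt] using h₂ t)⟩

/-- Up to isomorphism there is only a set of `κ₀`-presentable objects, so `μ` can bound the
presentability ranks of their images. For `κ ≥ μ` every `κ`-presentable object is a `κ`-small
directed colimit of these, and `H` preserves that colimit. -/
theorem AllMono.exists_preserves_presentable {K : Type u₁} [Category.{v₁} K] {L : Type u₂}
    [Category.{v₂} L] [AllMono K] [HasFilteredColimitsOfSize.{w, w} K]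
    [IsAccessibleCategory.{w} K] [LocallySmall.{w} L] (hL : ∀ X : L, IsPresentable.{w} X)
    (H : K ⥤ L) [PreservesFilteredColimitsOfSize.{w, w} H] :
    ∃ μ : Cardinal.{w}, μ.IsRegular ∧ ∀ (κ : Cardinal.{w}) [Fact κ.IsRegular], μ ≤ κ →
      IsCardinalAccessibleCategory K κ ∧
        ∀ X : K, IsCardinalPresentable X κ → IsCardinalPresentable (H.obj X) κ := by
  obtain ⟨κ₀, _, _⟩ := IsAccessibleCategory.exists_cardinal.{w} K
  obtain ⟨Q, _, hQ, hQ'⟩ :=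
    ObjectProperty.EssentiallySmall.exists_small_le.{w} (isCardinalPresentable K κ₀)
  have hp (q : Subtype Q) := (hL (H.obj q.1)).exists_cardinal
  choose κ₁ hκ₁ hκ₁' using hp
  obtain ⟨μ, hμ, hle⟩ := exists_regular_bound (T := Unit ⊕ Subtype Q) (Sum.elim (fun _ => κ₀) κ₁)
  have hle₀ : κ₀ ≤ μ := hle (.inl ())
  have hle₁ (q : Subtype Q) : κ₁ q ≤ μ := hle (.inr q)
  refine ⟨μ, hμ, fun κ _ hκ => ?_⟩
  obtain ⟨hacc, hcol⟩ := AllMono.isCardinalAccessible_of_le (K := K) (hle₀.trans hκ)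
  refine ⟨hacc, fun X hX => ?_⟩
  obtain ⟨J, _, _, _, hJ, ⟨c⟩⟩ := hcol X hX
  have := PreservesFilteredColimitsOfSize.preserves_filtered_colimits (F := H) J
  have hpres (j : J) : IsCardinalPresentable ((c.diag ⋙ H).obj j) κ := by
    obtain ⟨q, hq, ⟨e⟩⟩ := hQ' _ (c.prop_diag_obj j)
    have h₁ : IsCardinalPresentable (H.obj q) (κ₁ ⟨q, hq⟩) := hκ₁' ⟨q, hq⟩
    have h₂ : IsCardinalPresentable (H.obj q) κ :=
      isCardinalPresentable_of_le _ ((hle₁ ⟨q, hq⟩).trans hκ)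
    exact isCardinalPresentable_of_iso (H.mapIso e.symm) κ
  exact isCardinalPresentable_of_isColimit _ (isColimitOfPreserves H c.isColimit) κ
    (hasCardinalLT_arrow_of_preorder hJ)

/-! ### Arrow categories -/

section

variable {K : Type u} [Category.{v} K]

instance [AllMono K] : AllMono (Arrow K) where
  mono f := ⟨fun g h w => by
    ext
    · exact AllMono.cancel f.left (congrArg (fun k => k.left) w)
    · exact AllMono.cancel f.right (congrArg (fun k => k.right) w)⟩

instance [HasFilteredColimitsOfSize.{w, w} K] : HasFilteredColimitsOfSize.{w, w} (Arrow K) where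
  HasColimitsOfShape _ _ _ := inferInstance

instance [LocallySmall.{w} K] : LocallySmall.{w} (Arrow K) where
  hom_small X Y := by
    refine small_of_injective (β := (X.left ⟶ Y.left) × (X.right ⟶ Y.right))
      (f := fun φ => (φ.left, φ.right)) ?_
    intro φ ψ h
    ext
    · exact (Prod.mk.inj h).1
    · exact (Prod.mk.inj h).2

/-- The two components lift to stages separately. At a common later stage the resulting square
commutes because it does so after the monic leg. -/
theorem AllMono.arrow_isCardinalPresentable [AllMono K] [HasFilteredColimitsOfSize.{w, w} K]
    (κ : Cardinal.{w}) [Fact κ.IsRegular] (X : Arrow K) (h₁ : IsCardinalPresentable X.left κ)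
    (h₂ : IsCardinalPresentable X.right κ) : IsCardinalPresentable X κ := by
  refine AllMono.isCardinalPresentable_of_lift X κ fun J _ _ F c hc f => ?_
  have := isFiltered_of_isCardinalFiltered J κ
  obtain ⟨i, a, ha⟩ : ∃ (i : J) (a : X.left ⟶ (F.obj i).left), a ≫ (c.ι.app i).left = f.left :=
    IsCardinalPresentable.exists_hom_of_isColimit κ
      (isColimitOfPreserves Arrow.leftFunc hc) f.left
  obtain ⟨j, b, hb⟩ : ∃ (j : J) (b : X.right ⟶ (F.obj j).right),
      b ≫ (c.ι.app j).right = f.right :=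
    IsCardinalPresentable.exists_hom_of_isColimit κ
      (isColimitOfPreserves Arrow.rightFunc hc) f.right
  obtain ⟨k, p, q, -⟩ : ∃ (k : J) (_ : i ⟶ k) (_ : j ⟶ k), True :=
    ⟨IsFiltered.max i j, IsFiltered.leftToMax i j, IsFiltered.rightToMax i j, trivial⟩
  have hi : (F.map p).left ≫ (c.ι.app k).left = (c.ι.app i).left :=
    congrArg (fun φ => φ.left) (c.w p)
  have hj : (F.map q).right ≫ (c.ι.app k).right = (c.ι.app j).right :=
    congrArg (fun φ => φ.right) (c.w q)
  have hw : (c.ι.app k).left ≫ c.pt.hom = (F.obj k).hom ≫ (c.ι.app k).right :=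
    Arrow.w (c.ι.app k)
  have hf : f.left ≫ c.pt.hom = X.hom ≫ f.right := Arrow.w f
  refine ⟨k, Arrow.homMk (a ≫ (F.map p).left) (b ≫ (F.map q).right) ?_, ?_⟩
  · have : Mono (c.ι.app k).right := AllMono.mono _
    apply (cancel_mono (c.ι.app k).right).1
    simp only [Category.assoc, hj, hb, ← hw, ← hf, ← ha, ← hi]
  · ext
    · change (a ≫ (F.map p).left) ≫ (c.ι.app k).left = f.left
      rw [Category.assoc, hi, ha]
    · change (b ≫ (F.map q).right) ≫ (c.ι.app k).right = f.right
      rw [Category.assoc, hj, hb]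

/-- Enlarging the codomain until it contains the image of the domain turns a pair of small
subobjects into a small subarrow. -/
theorem exists_presentable_arrow (κ : Cardinal.{w}) [Fact κ.IsRegular]
    [IsCardinalAccessibleCategory K κ] (X : Arrow K) {a b : K} (ha : IsCardinalPresentable a κ)
    (hb : IsCardinalPresentable b κ) (s : a ⟶ X.left) (t : b ⟶ X.right) :
    ∃ (b' : K) (_ : IsCardinalPresentable b' κ) (r : a ⟶ b') (r' : b ⟶ b') (t' : b' ⟶ X.right),
      s ≫ X.hom = r ≫ t' ∧ r' ≫ t' = t := by
  obtain ⟨b', hb', t', ht'⟩ := exists_presentable_bound (X := X.right) (κ := κ)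
    (ι := ULift.{w} Bool)
    (hasCardinalLT_of_finite _ _ (Cardinal.IsRegular.aleph0_le Fact.out))
    (p := fun i => bif i.down then a else b) (by rintro ⟨_ | _⟩ <;> assumption)
    (by rintro ⟨_ | _⟩; exacts [t, s ≫ X.hom])
  obtain ⟨r, hr⟩ : ∃ r : a ⟶ b', r ≫ t' = s ≫ X.hom := ht' ⟨true⟩
  obtain ⟨r', hr'⟩ : ∃ r' : b ⟶ b', r' ≫ t' = t := ht' ⟨false⟩
  exact ⟨b', hb', r, r', t', hr.symm, hr'⟩

theorem exists_presentable_subobject (κ : Cardinal.{w}) [Fact κ.IsRegular]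
    [IsCardinalAccessibleCategory K κ] (X : K) :
    ∃ (a : K) (_ : IsCardinalPresentable a κ), Nonempty (a ⟶ X) := by
  obtain ⟨a, ha, f, -⟩ := exists_presentable_bound (X := X) (κ := κ) (ι := PEmpty.{w + 1})
    (hasCardinalLT_of_finite _ _ (Cardinal.IsRegular.aleph0_le Fact.out))
    (p := fun i => i.elim) (fun i => i.elim) (fun i => i.elim)
  exact ⟨a, ha, ⟨f⟩⟩

theorem AllMono.arrow_isCardinalAccessible [AllMono K] [HasFilteredColimitsOfSize.{w, w} K]
    (κ : Cardinal.{w}) [Fact κ.IsRegular] [IsCardinalAccessibleCategory K κ] :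
    IsCardinalAccessibleCategory (Arrow K) κ := by
  obtain ⟨Q, _, hQ, hQ'⟩ :=
    ObjectProperty.EssentiallySmall.exists_small_le.{w} (isCardinalPresentable K κ)
  let P : ObjectProperty (Arrow K) := fun X =>
    IsCardinalPresentable X.left κ ∧ IsCardinalPresentable X.right κ
  have : ObjectProperty.EssentiallySmall.{w} P := by
    refine essentiallySmall_of_family (T := Σ (a b : Subtype Q), (a.1 ⟶ b.1))
      (fun t => Arrow.mk t.2.2) fun X hX => ?_
    obtain ⟨a, ha, ⟨e⟩⟩ := hQ' _ hX.1
    obtain ⟨b, hb, ⟨e'⟩⟩ := hQ' _ hX.2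
    exact ⟨⟨⟨a, ha⟩, ⟨b, hb⟩, e.inv ≫ X.hom ≫ e'.hom⟩, ⟨Arrow.isoMk e e' (by simp)⟩⟩
  refine isCardinalAccessible_of_generator (P := P)
    (AllMono.isCardinalFilteredGenerator_of_subobjects κ P
      (fun X hX => AllMono.arrow_isCardinalPresentable κ X hX.1 hX.2) ?_ ?_)
  · intro X ι hι p hp f
    obtain ⟨b, hb, t, ht⟩ := exists_presentable_bound hι (fun i => (hp i).2) fun i => (f i).right
    obtain ⟨a, ha, s, hs⟩ := exists_presentable_bound hι (fun i => (hp i).1) fun i => (f i).left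
    obtain ⟨b', hb', r, r', t', hr, hr'⟩ := exists_presentable_arrow κ X ha hb s t
    refine ⟨Arrow.mk r, ⟨ha, hb'⟩, Arrow.homMk s t' hr, fun i => ?_⟩
    obtain ⟨k, hk⟩ := hs i
    obtain ⟨l, hl⟩ := ht i
    have hw : (f i).left ≫ X.hom = (p i).hom ≫ (f i).right := Arrow.w (f i)
    refine ⟨Arrow.homMk k (l ≫ r') ?_, ?_⟩
    · apply AllMono.cancel t'
      change (k ≫ r) ≫ t' = ((p i).hom ≫ l ≫ r') ≫ t'
      simp only [Category.assoc, ← hr, hr', hl]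
      rw [reassoc_of% hk, hw]
    · ext
      · exact hk
      · change (l ≫ r') ≫ t' = (f i).right
        rw [Category.assoc, hr', hl]
  · intro Z X m hm
    have h₁ : IsIso m.left := AllMono.isIso_of_forall_presentable (κ := κ) m.left fun p hp f => by
      obtain ⟨b, hb, ⟨t⟩⟩ := exists_presentable_subobject κ X.right
      obtain ⟨b', hb', r, r', t', hr, hr'⟩ := exists_presentable_arrow κ X hp hb f t
      obtain ⟨a, ha⟩ := hm (Arrow.mk r) ⟨hp, hb'⟩ (Arrow.homMk f t' hr)
      exact ⟨a.left, congrArg (fun φ => φ.left) ha⟩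
    have h₂ : IsIso m.right :=
        AllMono.isIso_of_forall_presentable (κ := κ) m.right fun p hp f => by
      obtain ⟨b, hb, ⟨t⟩⟩ := exists_presentable_subobject κ X.left
      obtain ⟨b', hb', r, r', t', hr, hr'⟩ := exists_presentable_arrow κ X hb hp t f
      obtain ⟨a, ha⟩ := hm (Arrow.mk r) ⟨hb, hb'⟩ (Arrow.homMk t t' hr)
      refine ⟨r' ≫ a.right, ?_⟩
      have : a.right ≫ m.right = t' := congrArg (fun φ => φ.right) ha
      rw [Category.assoc, this, hr']
    exact Arrow.isIso_of_isIso_left_of_isIso_right m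

end

/-! ### Colimits in wide subcategories -/

section

variable {A : Type u} [Category.{v} A] (W : MorphismProperty A) [W.IsMultiplicative]

instance [AllMono A] : AllMono (WideSubcategory W) :=
  .of_faithful (wideSubcategoryInclusion W) fun _ => AllMono.mono _

theorem WideSubcategory.allMono (h : W ≤ MorphismProperty.monomorphisms A) :
    AllMono (WideSubcategory W) :=
  .of_faithful (wideSubcategoryInclusion W) fun f => h _ f.property

instance [LocallySmall.{w} A] : LocallySmall.{w} (WideSubcategory W) where
  hom_small X Y := small_of_injective (β := X.obj ⟶ Y.obj) (f := fun φ => φ.hom)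
    fun _ _ h => WideSubcategory.hom_ext W h

variable {W} {J : Type u₁} [Category.{v₁} J] {D : J ⥤ WideSubcategory W}

/-- A cocone in the ambient category with legs in `W` defines a cocone in `WideSubcategory W`. -/
def wideCocone (c : Cocone (D ⋙ wideSubcategoryInclusion W)) (h : ∀ j, W (c.ι.app j)) :
    Cocone D where
  pt := ⟨c.pt⟩
  ι :=
    { app := fun j => ⟨c.ι.app j, h j⟩
      naturality := fun _ _ f => WideSubcategory.hom_ext W (c.ι.naturality f) }

/-- A colimit cocone in the ambient category is a colimit cocone in `WideSubcategory W` if the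
induced morphisms to cocones with legs in `W` are in `W`. -/
def wideCoconeIsColimit {c : Cocone (D ⋙ wideSubcategoryInclusion W)} (hc : IsColimit c)
    (h : ∀ j, W (c.ι.app j)) (hdesc : ∀ s : Cocone D,
      W (hc.desc ((wideSubcategoryInclusion W).mapCocone s))) :
    IsColimit (wideCocone c h) where
  desc s := ⟨hc.desc ((wideSubcategoryInclusion W).mapCocone s), hdesc s⟩
  fac s j := WideSubcategory.hom_ext W (hc.fac ((wideSubcategoryInclusion W).mapCocone s) j)
  uniq s m hm := WideSubcategory.hom_ext W
    (hc.uniq ((wideSubcategoryInclusion W).mapCocone s) m.hom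
      fun j => congrArg (fun φ => φ.hom) (hm j))

theorem isIso_wide (hW : ∀ {X Y : A} (f : X ⟶ Y) [IsIso f], W f) {X Y : WideSubcategory W}
    (f : X ⟶ Y) [IsIso f.hom] : IsIso f :=
  ⟨⟨inv f.hom, hW _⟩, WideSubcategory.hom_ext W (IsIso.hom_inv_id f.hom),
    WideSubcategory.hom_ext W (IsIso.inv_hom_id f.hom)⟩

/-- If the colimit of `D` in `WideSubcategory W` exists and is preserved by the inclusion, then
any ambient colimit cocone has its legs in `W`, and so has the morphism it induces to any
cocone with legs in `W`. -/
theorem wide_of_preservesColimit (hW : ∀ {X Y : A} (f : X ⟶ Y) [IsIso f], W f) [HasColimit D]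
    [PreservesColimit D (wideSubcategoryInclusion W)]
    {c : Cocone (D ⋙ wideSubcategoryInclusion W)} (hc : IsColimit c) :
    (∀ j, W (c.ι.app j)) ∧
      ∀ s : Cocone D, W (hc.desc ((wideSubcategoryInclusion W).mapCocone s)) := by
  let hc₀ := isColimitOfPreserves (wideSubcategoryInclusion W) (colimit.isColimit D)
  let e := hc₀.coconePointUniqueUpToIso hc
  constructor
  · intro j
    rw [← hc₀.comp_coconePointUniqueUpToIso_hom hc j]
    exact W.comp_mem _ _ (colimit.ι D j).property (hW e.hom)
  · intro s
    have : hc.desc ((wideSubcategoryInclusion W).mapCocone s) =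
        e.inv ≫ (colimit.desc D s).hom := by
      refine hc.hom_ext fun j => ?_
      rw [hc.fac]
      refine Eq.trans ?_ (Category.assoc _ _ _)
      refine Eq.trans ?_
        (congrArg (· ≫ _) (hc₀.comp_coconePointUniqueUpToIso_inv hc j)).symm
      exact (congrArg (fun φ => φ.hom) (colimit.ι_desc s j)).symm
    rw [this]
    exact W.comp_mem _ _ (hW e.inv) (colimit.desc D s).property

end

/-! ### Chains of subobjects -/

section

variable {A : Type u} [Category.{v} A] [AllMono A] {J : Type w} [Preorder J] {X : A} {a : J → A}
  (f : ∀ j, a j ⟶ X) (h : ∀ i j, i ≤ j → ∃ r : a i ⟶ a j, r ≫ f j = f i)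

/-- The diagram of an increasing family of subobjects of `X`. -/
noncomputable def subobjectDiagram : J ⥤ A where
  obj := a
  map g := (h _ _ (leOfHom g)).choose
  map_id j := AllMono.cancel (f j) (by rw [(h j j le_rfl).choose_spec, Category.id_comp])
  map_comp {i j k} g g' := AllMono.cancel (f k) (by
    rw [(h i k (leOfHom (g ≫ g'))).choose_spec, Category.assoc,
      (h j k (leOfHom g')).choose_spec, (h i j (leOfHom g)).choose_spec])

/-- The cocone given by an increasing family of subobjects of `X`. -/
noncomputable def subobjectCocone : Cocone (subobjectDiagram f h) where
  pt := X
  ι :=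
    { app := f
      naturality := fun i j g => (h i j (leOfHom g)).choose_spec.trans (Category.comp_id _).symm }

end

theorem exists_chain_map {A : Type u} [Category.{v} A] {X : A} {a : ℕ → A} (f : ∀ n, a n ⟶ X)
    (h : ∀ n, ∃ r : a n ⟶ a (n + 1), r ≫ f (n + 1) = f n) {i j : ℕ} (hij : i ≤ j) :
    ∃ r : a i ⟶ a j, r ≫ f j = f i := by
  induction j, hij using Nat.le_induction with
  | base => exact ⟨𝟙 _, Category.id_comp _⟩
  | succ j _ ih =>
    obtain ⟨r, hr⟩ := ih
    obtain ⟨s, hs⟩ := h j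
    exact ⟨r ≫ s, by rw [Category.assoc, hs, hr]⟩

/-- The union of a chain of subobjects. -/
theorem AllMono.exists_chain_colimit {A : Type u₁} [Category.{v₁} A] [AllMono A]
    [LocallySmall.{w} A] [HasFilteredColimitsOfSize.{w, w} A] {X : A} {a : ℕ → A}
    (f : ∀ n, a n ⟶ X) (h : ∀ n, ∃ r : a n ⟶ a (n + 1), r ≫ f (n + 1) = f n) :
    ∃ (c : A) (g : c ⟶ X) (i : ∀ n, a n ⟶ c), (∀ n, i n ≫ g = f n) ∧
      (∀ (κ : Cardinal.{w}) [Fact κ.IsRegular], Cardinal.aleph0 < κ →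
        (∀ n, IsCardinalPresentable (a n) κ) → IsCardinalPresentable c κ) ∧
      ∀ {B : Type u₂} [Category.{v₂} B] [AllMono B] (G : A ⥤ B)
        [PreservesFilteredColimitsOfSize.{w, w} G] {Y Z : B} (p : G.obj c ⟶ Z) (q : Y ⟶ Z),
        (∀ n, ∃ k : G.obj (a n) ⟶ Y, k ≫ q = G.map (i n) ≫ p) →
          ∃ k : G.obj c ⟶ Y, k ≫ q = p := by
  have hchain (i j : ULift.{w} ℕ) (hij : i ≤ j) :
      ∃ r : a i.down ⟶ a j.down, r ≫ f j.down = f i.down := exists_chain_map f h hij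
  let F := subobjectDiagram (fun n : ULift.{w} ℕ => f n.down) hchain
  refine ⟨colimit F, colimit.desc F (subobjectCocone _ hchain), fun n => colimit.ι F ⟨n⟩,
    fun n => colimit.ι_desc _ _, ?_, ?_⟩
  · intro κ _ hκ ha
    have : ∀ n, IsCardinalPresentable (F.obj n) κ := fun n => ha n.down
    refine isCardinalPresentable_of_isColimit _ (colimit.isColimit F) κ
      (hasCardinalLT_arrow_of_preorder ?_)
    rw [HasCardinalLT]
    simpa using hκ
  · intro B _ _ G _ Y Z p q hpq
    have := PreservesFilteredColimitsOfSize.preserves_filtered_colimits (F := G) (ULift.{w} ℕ)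
    exact AllMono.exists_lift_of_isColimit (isColimitOfPreserves G (colimit.isColimit F)) p q
      fun n => hpq n.down

theorem isCardinalAccessible_of_preservesFilteredColimits {A : Type u₁} [Category.{v₁} A]
    {B : Type u₂} [Category.{v₂} B] (G : A ⥤ B) [PreservesFilteredColimitsOfSize.{w, w} G]
    (κ : Cardinal.{w}) [Fact κ.IsRegular] : G.IsCardinalAccessible κ where
  preservesColimitOfShape J _ _ := by
    have := isFiltered_of_isCardinalFiltered J κ
    exact PreservesFilteredColimitsOfSize.preserves_filtered_colimits J

/-! ### Pulling back a wide subcategory along a functor -/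

section

variable {A : Type u₁} [Category.{v₁} A] {B : Type u₂} [Category.{v₂} B] (G : A ⥤ B)
  (V : MorphismProperty A) [V.IsMultiplicative] (W : MorphismProperty B) [W.IsMultiplicative]
  (hVW : ∀ {X Y : A} (f : X ⟶ Y), V f ↔ W (G.map f))

/-- The functor between wide subcategories induced by a functor. -/
def wideMap : WideSubcategory V ⥤ WideSubcategory W where
  obj X := ⟨G.obj X.obj⟩
  map f := ⟨G.map f.hom, (hVW _).1 f.property⟩
  map_id X := WideSubcategory.hom_ext W (G.map_id X.obj)
  map_comp f g := WideSubcategory.hom_ext W (G.map_comp f.hom g.hom)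

variable {G V W}

include hVW in
-- `G` sends the ambient colimit to a colimit whose legs and induced morphisms lie in `W`.
-- Membership in `V` is tested after `G`, so the original cocone is a colimit in the wide
-- subcategory.
theorem wide_isColimit_pullback (hW : ∀ {X Y : B} (f : X ⟶ Y) [IsIso f], W f) {J : Type u}
    [Category.{v} J] (D : J ⥤ WideSubcategory V) [HasColimitsOfShape J (WideSubcategory W)]
    [PreservesColimitsOfShape J (wideSubcategoryInclusion W)] [PreservesColimitsOfShape J G]
    {c : Cocone (D ⋙ wideSubcategoryInclusion V)} (hc : IsColimit c) :
    ∃ h : ∀ j, V (c.ι.app j), Nonempty (IsColimit (wideCocone c h)) := by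
  let D' := D ⋙ wideMap G V W hVW
  let c' : Cocone (D' ⋙ wideSubcategoryInclusion W) := G.mapCocone c
  let hc' : IsColimit c' := isColimitOfPreserves G hc
  obtain ⟨h₁, h₂⟩ := wide_of_preservesColimit (D := D') hW hc'
  refine ⟨fun j => (hVW _).2 (h₁ j), ⟨wideCoconeIsColimit hc _ fun s => (hVW _).2 ?_⟩⟩
  have e : G.map (hc.desc ((wideSubcategoryInclusion V).mapCocone s)) =
      hc'.desc ((wideSubcategoryInclusion W).mapCocone ((wideMap G V W hVW).mapCocone s)) :=
    hc'.hom_ext fun j => ((G.map_comp _ _).symm.trans (congrArg G.map (hc.fac _ j))).trans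
      (hc'.fac ((wideSubcategoryInclusion W).mapCocone ((wideMap G V W hVW).mapCocone s)) j).symm
  rw [e]
  exact h₂ ((wideMap G V W hVW).mapCocone s)

variable (hW : ∀ {X Y : B} (f : X ⟶ Y) [IsIso f], W f)
  [HasFilteredColimitsOfSize.{w, w} A] [HasFilteredColimitsOfSize.{w, w} (WideSubcategory W)]
  [PreservesFilteredColimitsOfSize.{w, w} (wideSubcategoryInclusion W)]
  [PreservesFilteredColimitsOfSize.{w, w} G]

include hVW hW

theorem wide_pullback_hasFilteredColimits :
    HasFilteredColimitsOfSize.{w, w} (WideSubcategory V) where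
  HasColimitsOfShape J _ _ := ⟨fun D => by
    have := PreservesFilteredColimitsOfSize.preserves_filtered_colimits (F := G) J
    have := PreservesFilteredColimitsOfSize.preserves_filtered_colimits
      (F := wideSubcategoryInclusion W) J
    obtain ⟨h, ⟨hc⟩⟩ := wide_isColimit_pullback hVW hW D
      (colimit.isColimit (D ⋙ wideSubcategoryInclusion V))
    exact HasColimit.mk ⟨_, hc⟩⟩

theorem wide_pullback_preservesFilteredColimits :
    PreservesFilteredColimitsOfSize.{w, w} (wideSubcategoryInclusion V) where
  preserves_filtered_colimits J _ _ := ⟨fun {D} => by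
    have := PreservesFilteredColimitsOfSize.preserves_filtered_colimits (F := G) J
    have := PreservesFilteredColimitsOfSize.preserves_filtered_colimits
      (F := wideSubcategoryInclusion W) J
    have hc₀ := colimit.isColimit (D ⋙ wideSubcategoryInclusion V)
    obtain ⟨h, ⟨hc⟩⟩ := wide_isColimit_pullback hVW hW D hc₀
    exact preservesColimit_of_preserves_colimit_cocone hc hc₀⟩

variable [AllMono A] [AllMono B] [IsAccessibleCategory.{w} A] [LocallySmall.{w} A]
  [LocallySmall.{w} B] (hB : ∀ X : B, IsPresentable.{w} X)
  [IsAccessibleCategory.{w} (WideSubcategory W)]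
  (hcancel : ∀ {X Y Z : B} (f : X ⟶ Y) (g : Y ⟶ Z), W (f ≫ g) → W f)

include hB hcancel

/-- The preimage of an accessible wide subcategory, closed under directed colimits and left
cancellable, is accessible. -/
theorem wide_pullback_isAccessible : IsAccessibleCategory.{w} (WideSubcategory V) := by
  have hfc := wide_pullback_hasFilteredColimits hVW hW
  have hpres := wide_pullback_preservesFilteredColimits hVW hW
  obtain ⟨μ₁, hμ₁, h₁⟩ := AllMono.exists_preserves_presentable hB G
  obtain ⟨μ₂, hμ₂, h₂⟩ := AllMono.exists_preserves_presentable hB (wideSubcategoryInclusion W)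
  -- Above `μ₁` and `μ₂`, both `G` and the inclusion of `W` preserve `κ`-presentable objects;
  -- uncountability keeps unions of `ω`-chains `κ`-presentable.
  obtain ⟨κ, hκ, hκ₀, hκ₁, hκ₂⟩ : ∃ κ : Cardinal.{w}, κ.IsRegular ∧ Cardinal.aleph0 < κ ∧
      μ₁ ≤ κ ∧ μ₂ ≤ κ := by
    obtain ⟨κ, h, hle⟩ := exists_regular_bound.{w}
      (fun i : Fin 3 => ![Order.succ Cardinal.aleph0, μ₁, μ₂] i)
    exact ⟨κ, h, (Order.lt_succ _).trans_le (hle 0), hle 1, hle 2⟩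
  have : Fact κ.IsRegular := ⟨hκ⟩
  obtain ⟨hA, hG⟩ := h₁ κ hκ₁
  obtain ⟨hWκ, hι⟩ := h₂ κ hκ₂
  have := isCardinalAccessible_of_preservesFilteredColimits G κ
  have := isCardinalAccessible_of_preservesFilteredColimits (wideSubcategoryInclusion W) κ
  -- Löwenheim–Skolem: every small subobject of `X` lies in a small one whose inclusion is in `V`.
  -- Small subobjects `a n` of `X` in `A` and `p n` of `G X` in the wide subcategory of `W` are
  -- interleaved as `G (a n) ≤ p n ≤ G (a (n + 1))`.
  have LS : ∀ (X a : A) (_ : IsCardinalPresentable a κ) (f : a ⟶ X),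
      ∃ (b : A) (_ : IsCardinalPresentable b κ) (g : b ⟶ X) (r : a ⟶ b), V g ∧ r ≫ g = f := by
    intro X
    let T : Type _ := { t : Σ a : A, (a ⟶ X) // IsCardinalPresentable t.1 κ }
    have step₁ (t : T) : ∃ (p : WideSubcategory W) (q : p ⟶ ⟨G.obj X⟩) (s : G.obj t.1.1 ⟶ p.obj),
        s ≫ q.hom = G.map t.1.2 ∧ IsCardinalPresentable p κ := by
      have := hG _ t.2
      obtain ⟨p, hp, q, s, hs⟩ := exists_presentable_lift_map (κ := κ)
        (wideSubcategoryInclusion W) (X := ⟨G.obj X⟩) (G.map t.1.2)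
      exact ⟨p, q, s, hs, hp⟩
    choose p q s hs hp using step₁
    have step₂ (t : T) : ∃ (t' : T) (r : t.1.1 ⟶ t'.1.1) (l : (p t).obj ⟶ G.obj t'.1.1),
        r ≫ t'.1.2 = t.1.2 ∧ l ≫ G.map t'.1.2 = (q t).hom := by
      have : IsCardinalPresentable (p t).obj κ := hι _ (hp t)
      obtain ⟨b, hb, g, l, hl⟩ := exists_presentable_lift_map (κ := κ) G (q t).hom
      obtain ⟨c, hc, e, he⟩ := exists_presentable_bound (X := X) (κ := κ)
        (ι := ULift.{w} Bool)
        (hasCardinalLT_of_finite _ _ (Cardinal.IsRegular.aleph0_le Fact.out))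
        (p := fun i => bif i.down then b else t.1.1)
        (by rintro ⟨_ | _⟩; exacts [t.2, hb])
        (by rintro ⟨_ | _⟩; exacts [t.1.2, g])
      obtain ⟨m, hm⟩ : ∃ m : b ⟶ c, m ≫ e = g := he ⟨true⟩
      obtain ⟨r, hr⟩ : ∃ r : t.1.1 ⟶ c, r ≫ e = t.1.2 := he ⟨false⟩
      exact ⟨⟨⟨c, e⟩, hc⟩, r, l ≫ G.map m, hr, by rw [Category.assoc, ← G.map_comp, hm, hl]⟩
    choose next r l hr hl using step₂
    intro a ha f
    let t : ℕ → T := fun n => Nat.rec (motive := fun _ => T) ⟨⟨a, f⟩, ha⟩ (fun _ => next) n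
    obtain ⟨c, v, i, hv, hc, hlift⟩ := AllMono.exists_chain_colimit (fun n => (t n).1.2)
      fun n => ⟨r (t n), hr (t n)⟩
    obtain ⟨c', v', i', hv', -, hlift'⟩ := AllMono.exists_chain_colimit (fun n => q (t n))
      fun n => by
        have hw : (l (t n) ≫ s (t (n + 1))) ≫ (q (t (n + 1))).hom = (q (t n)).hom := by
          rw [Category.assoc, hs]
          exact hl (t n)
        refine ⟨⟨l (t n) ≫ s (t (n + 1)), hcancel _ (q (t (n + 1))).hom ?_⟩,
          WideSubcategory.hom_ext W hw⟩
        rw [hw]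
        exact (q (t n)).property
    have hv'' (n : ℕ) : (i' n).hom ≫ v'.hom = (q (t n)).hom :=
      congrArg (fun φ => φ.hom) (hv' n)
    obtain ⟨φ, hφ⟩ := hlift G (G.map v) v'.hom fun n =>
      ⟨s (t n) ≫ (i' n).hom, by rw [Category.assoc, hv'', hs, ← G.map_comp, hv]⟩
    have hl' (n : ℕ) : l (t n) ≫ G.map (i (n + 1)) ≫ G.map v = (i' n).hom ≫ v'.hom := by
      rw [← G.map_comp, hv, hv'']
      exact hl (t n)
    obtain ⟨ψ, hψ⟩ : ∃ ψ : c'.obj ⟶ G.obj c, ψ ≫ G.map v = v'.hom :=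
      hlift' (wideSubcategoryInclusion W) (Z := G.obj X) v'.hom (G.map v) fun n =>
        ⟨l (t n) ≫ G.map (i (n + 1)), (Category.assoc _ _ _).trans (hl' n)⟩
    -- The interleaved chains have the same union, so `G c` is isomorphic over `G X` to the union of
    -- the `p n`, whose inclusion lies in `W`.
    have hiso : IsIso φ :=
      ⟨ψ, AllMono.cancel (G.map v) (by rw [Category.assoc, hψ, hφ, Category.id_comp]),
        AllMono.cancel v'.hom (by rw [Category.assoc, hφ, hψ, Category.id_comp])⟩
    refine ⟨c, hc κ hκ₀ fun n => (t n).2, v, i 0, (hVW v).2 ?_, hv 0⟩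
    rw [← hφ]
    exact W.comp_mem _ _ (hW φ) v'.property
  obtain ⟨Q, _, hQ, hQ'⟩ :=
    ObjectProperty.EssentiallySmall.exists_small_le.{w} (isCardinalPresentable A κ)
  let P : ObjectProperty (WideSubcategory V) := fun X => IsCardinalPresentable X.obj κ
  have : ObjectProperty.EssentiallySmall.{w} P := by
    refine essentiallySmall_of_family (T := Subtype Q) (fun t => ⟨t.1⟩) fun X hX => ?_
    obtain ⟨q, hq, ⟨e⟩⟩ := hQ' _ hX
    exact ⟨⟨q, hq⟩, ⟨WideSubcategory.isoMk e ((hVW _).2 (hW _)) ((hVW _).2 (hW _))⟩⟩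
  have hP : P ≤ isCardinalPresentable _ κ := by
    intro X hX
    refine AllMono.isCardinalPresentable_of_lift X κ fun J _ _ F c hc f => ?_
    have := isFiltered_of_isCardinalFiltered J κ
    have := PreservesFilteredColimitsOfSize.preserves_filtered_colimits
      (F := wideSubcategoryInclusion V) J
    obtain ⟨j, g, hg⟩ : ∃ (j : J) (g : X.obj ⟶ (F.obj j).obj), g ≫ (c.ι.app j).hom = f.hom :=
      have : IsCardinalPresentable X.obj κ := hX
      IsCardinalPresentable.exists_hom_of_isColimit κ
        (isColimitOfPreserves (wideSubcategoryInclusion V) hc) f.hom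
    refine ⟨j, ⟨g, (hVW _).2 (hcancel _ (G.map (c.ι.app j).hom) ?_)⟩,
      WideSubcategory.hom_ext V hg⟩
    rw [← G.map_comp, hg]
    exact (hVW _).1 f.property
  refine ⟨κ, inferInstance, isCardinalAccessible_of_generator (P := P)
    (AllMono.isCardinalFilteredGenerator_of_subobjects κ P hP ?_ ?_)⟩
  · intro X ι hι p hp f
    obtain ⟨q, hq, g, hg⟩ := exists_presentable_bound hι hp fun i => (f i).hom
    obtain ⟨b, hb, t, r, ht, hr⟩ := LS X.obj q hq g
    refine ⟨⟨b⟩, hb, ⟨t, ht⟩, fun i => ?_⟩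
    obtain ⟨a, ha⟩ := hg i
    have hw : (a ≫ r) ≫ t = (f i).hom := by rw [Category.assoc, hr, ha]
    refine ⟨⟨a ≫ r, (hVW _).2 (hcancel _ (G.map t) ?_)⟩, WideSubcategory.hom_ext V hw⟩
    rw [← G.map_comp, hw]
    exact (hVW _).1 (f i).property
  · intro Z X m hm
    have : IsIso m.hom := AllMono.isIso_of_forall_presentable (κ := κ) m.hom fun p hp f => by
      obtain ⟨b, hb, t, r, ht, hr⟩ := LS X.obj p hp f
      obtain ⟨a, ha⟩ := hm ⟨b⟩ hb ⟨t, ht⟩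
      have : a.hom ≫ m.hom = t := congrArg (fun φ => φ.hom) ha
      exact ⟨r ≫ a.hom, by rw [Category.assoc, this, hr]⟩
    exact isIso_wide (fun f _ => (hVW f).2 (hW _)) m

end

/-! ### Members of multicoreflections and of multicolimits -/

/-- The morphism `e : F X ⟶ d` is a member of the multicoreflection of `d` along `F`, that is, a
terminal object of its connected component in the comma category. -/
structure IsLocalCoreflection {C : Type u₁} [Category.{v₁} C] {D : Type u₂} [Category.{v₂} D]
    (F : C ⥤ D) {X : C} {d : D} (e : F.obj X ⟶ d) : Prop where
  ext : ∀ {c : C} {g h : c ⟶ X}, F.map g ≫ e = F.map h ≫ e → g = h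
  lift : ∀ {b c : C} (p : c ⟶ X) (q : c ⟶ b) (g : F.obj b ⟶ d), F.map p ≫ e = F.map q ≫ g →
    ∃ g' : b ⟶ X, F.map g' ≫ e = g

theorem IsLocalCoreflection.lift_comp {C : Type u₁} [Category.{v₁} C] {D : Type u₂}
    [Category.{v₂} D] {F : C ⥤ D} {X : C} {d : D} {e : F.obj X ⟶ d}
    (he : IsLocalCoreflection F e) {b c : C} (p : c ⟶ X) (q : c ⟶ b) (g : F.obj b ⟶ d)
    (h : F.map p ≫ e = F.map q ≫ g) : ∃ g' : b ⟶ X, F.map g' ≫ e = g ∧ q ≫ g' = p := by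
  obtain ⟨g', hg'⟩ := he.lift p q g h
  exact ⟨g', hg', he.ext (by rw [F.map_comp, Category.assoc, hg', h])⟩

theorem IsLeftMultiadjoint.exists_localCoreflection {C : Type u₁} [Category.{v₁} C] {D : Type u₂}
    [Category.{v₂} D] {F : C ⥤ D} (hF : IsLeftMultiadjoint.{w} F) {a : C} {d : D}
    (f : F.obj a ⟶ d) : ∃ (X : C) (e : F.obj X ⟶ d) (_ : IsLocalCoreflection F e) (f' : a ⟶ X),
      F.map f' ≫ e = f := by
  obtain ⟨ι, X, e, he⟩ := hF d
  obtain ⟨⟨i, f'⟩, hf', -⟩ := he a f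
  refine ⟨X i, e i, ⟨fun {c g h} hgh => ?_, fun {b c} p q g hpq => ?_⟩, f', hf'⟩
  · have : (⟨i, g⟩ : Σ i : ι, c ⟶ X i) = ⟨i, h⟩ := (he c (F.map h ≫ e i)).unique hgh rfl
    exact eq_of_heq (Sigma.mk.inj this).2
  · obtain ⟨⟨j, g'⟩, hg', -⟩ := he b g
    have : (⟨i, p⟩ : Σ i : ι, c ⟶ X i) = ⟨j, q ≫ g'⟩ :=
      (he c (F.map q ≫ g)).unique hpq (by
        have hg'' : F.map g' ≫ e j = g := hg'
        simp [hg''])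
    obtain rfl : i = j := (Sigma.mk.inj this).1
    exact ⟨g', hg'⟩

/-- The cocone is a member of a multicolimit, that is, an initial object of its connected
component in the category of cocones. -/
structure IsLocalColimit {C : Type u} [Category.{v} C] {J : Type u₁} [Category.{v₁} J]
    {K : J ⥤ C} (c : Cocone K) : Prop where
  ext : ∀ {Z : C} {g h : c.pt ⟶ Z}, (∀ j, c.ι.app j ≫ g = c.ι.app j ≫ h) → g = h
  desc : ∀ (s : Cocone K) {Z : C} (x : c.pt ⟶ Z) (z : s.pt ⟶ Z),
    (∀ j, c.ι.app j ≫ x = s.ι.app j ≫ z) → ∃ g : c.pt ⟶ s.pt, ∀ j, c.ι.app j ≫ g = s.ι.app j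

theorem IsMulticocomplete.exists_localColimit {C : Type u} [Category.{v} C]
    (hC : IsMulticocomplete.{w} C) {J : Type w} [SmallCategory J] {K : J ⥤ C} (s : Cocone K) :
    ∃ (c : Cocone K) (_ : IsLocalColimit c) (g : c.pt ⟶ s.pt),
      ∀ j, c.ι.app j ≫ g = s.ι.app j := by
  obtain ⟨ι, c, hc⟩ := hC J K
  obtain ⟨⟨i, g⟩, hg, -⟩ := hc s
  refine ⟨c i, ⟨fun {Z g h} hgh => ?_, fun s {Z} x z hxz => ?_⟩, g, hg⟩
  · have : (⟨i, g⟩ : Σ i : ι, (c i).pt ⟶ Z) = ⟨i, h⟩ :=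
      (hc ((c i).extend h)).unique (fun j => by simpa using hgh j) (fun j => by simp)
    exact eq_of_heq (Sigma.mk.inj this).2
  · obtain ⟨⟨k, g'⟩, hg', -⟩ := hc s
    have : (⟨i, x⟩ : Σ i : ι, (c i).pt ⟶ Z) = ⟨k, g' ≫ z⟩ :=
      (hc (s.extend z)).unique (fun j => by simpa using hxz j) (fun j => by
        have := hg' j
        simp [← this])
    obtain rfl : i = k := (Sigma.mk.inj this).1
    exact ⟨g', hg'⟩

/-- A left multiadjoint sends the legs of a local colimit to a jointly epimorphic family. -/
theorem IsLocalColimit.map_ext {C : Type u₁} [Category.{v₁} C] {D : Type u₂}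
    [Category.{v₂} D] {F : C ⥤ D} (hF : IsLeftMultiadjoint.{w} F) {J : Type u} [Category.{v} J]
    [Nonempty J] {K : J ⥤ C} {c : Cocone K} (hc : IsLocalColimit c) {d : D}
    {g h : F.obj c.pt ⟶ d} (H : ∀ j, F.map (c.ι.app j) ≫ g = F.map (c.ι.app j) ≫ h) : g = h := by
  obtain ⟨X, e, he, g', hg'⟩ := hF.exists_localCoreflection g
  let j₀ : J := Classical.arbitrary J
  -- Agreement on a single leg already forces `h` through the same member of the multicoreflection
  -- as `g`; this is where `J` must be nonempty.
  obtain ⟨h', hh'⟩ := he.lift (c.ι.app j₀ ≫ g') (c.ι.app j₀) h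
    (by rw [F.map_comp, Category.assoc, hg', H])
  rw [← hg', ← hh']
  congr 2
  refine hc.ext fun j => he.ext ?_
  rw [F.map_comp, F.map_comp, Category.assoc, Category.assoc, hg', hh', H]

/-! ### Colimits in the wide subcategory of a left cancellable class of monomorphisms -/

section

variable {C : Type u₁} [Category.{v₁} C] {M : MorphismProperty C} [M.IsMultiplicative]
  (hM : M ≤ MorphismProperty.monomorphisms C)
  (hcancel : ∀ {X Y Z : C} (f : X ⟶ Y) (g : Y ⟶ Z), M (f ≫ g) → M f)

include hM hcancel

/-- The ambient colimit `Q` maps to the colimit in the wide subcategory, so cancellation puts its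
legs in `M`. The induced map `δ` back to `Q` is a split epimorphism and, being in `M`, monic. -/
theorem preservesColimitsOfShape_wideSubcategoryInclusion {J : Type u} [Category.{v} J]
    [HasColimitsOfShape J C] [HasColimitsOfShape J (WideSubcategory M)] :
    PreservesColimitsOfShape J (wideSubcategoryInclusion M) where
  preservesColimit {K} := by
    let ι := wideSubcategoryInclusion M
    let Q := colimit.cocone (K ⋙ ι)
    let hQ : IsColimit Q := colimit.isColimit (K ⋙ ι)
    let α : Q.pt ⟶ (colimit K).obj := hQ.desc (ι.mapCocone (colimit.cocone K))
    have hα (j : J) : Q.ι.app j ≫ α = (colimit.ι K j).hom := hQ.fac _ j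
    have hleg (j : J) : M (Q.ι.app j) := hcancel _ α (by
      rw [hα]
      exact (colimit.ι K j).property)
    let δ : colimit K ⟶ ⟨Q.pt⟩ := colimit.desc K (wideCocone Q hleg)
    have hδ (j : J) : (colimit.ι K j).hom ≫ δ.hom = Q.ι.app j :=
      congrArg (fun φ => φ.hom) (colimit.ι_desc (wideCocone Q hleg) j)
    have h₁ : α ≫ δ.hom = 𝟙 Q.pt := hQ.hom_ext fun j => by
      rw [← Category.assoc]
      refine (congrArg (· ≫ δ.hom) (hα j)).trans ?_
      exact (hδ j).trans (Category.comp_id _).symm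
    have : Mono δ.hom := hM _ δ.property
    have h₂ : δ.hom ≫ α = 𝟙 _ := by
      rw [← cancel_mono δ.hom, Category.assoc, h₁, Category.comp_id, Category.id_comp]
    have : IsIso (hQ.desc (ι.mapCocone (colimit.cocone K))) := ⟨δ.hom, h₁, h₂⟩
    exact preservesColimit_of_preserves_colimit_cocone (colimit.isColimit K) hQ.ofPointIso

end

section

variable {C : Type u₁} [Category.{v₁} C] {D : Type u₂} [Category.{v₂} D]
  (hC : IsMulticocomplete.{w} C) {F : C ⥤ D} (hF : IsLeftMultiadjoint.{w} F)
  {M : MorphismProperty D} [M.IsMultiplicative]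
  (hM : M ≤ MorphismProperty.monomorphisms D)
  (hcancel : ∀ {X Y Z : D} (f : X ⟶ Y) (g : Y ⟶ Z), M (f ≫ g) → M f)

include hC hF hM hcancel

/-- The candidate is a local colimit `c` of `K` in `C`, in the component singled out by a
coreflection of the colimit `P` taken in `D_M`. Joint epimorphy of the legs of `F c` and monicity of
the comparison `P ⟶ F c` identify the two. -/
theorem exists_isColimit_restrictFunctor {J : Type w} [SmallCategory J] [IsFiltered J]
    [HasColimitsOfShape J (WideSubcategory M)] (K : J ⥤ WideSubcategory (M.inverseImage F)) :
    ∃ c : Cocone K, Nonempty (IsColimit c) ∧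
      Nonempty (IsColimit ((restrictFunctor F M).mapCocone c)) := by
  have : Nonempty J := IsFiltered.nonempty
  let F' := restrictFunctor F M
  let P := colimit (K ⋙ F')
  let p (j : J) : F.obj (K.obj j).obj ⟶ P.obj := (colimit.ι (K ⋙ F') j).hom
  have hp {i j : J} (a : i ⟶ j) : F.map (K.map a).hom ≫ p j = p i :=
    congrArg (fun φ => φ.hom) (colimit.w (K ⋙ F') a)
  let j₀ : J := Classical.arbitrary J
  obtain ⟨X, e, he, f₀, hf₀⟩ := hF.exists_localCoreflection (p j₀)
  -- Any `j` and `j₀` have a common upper bound, so every leg factors through the coreflection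
  -- chosen for `j₀`.
  have hx (j : J) : ∃ x : (K.obj j).obj ⟶ X, F.map x ≫ e = p j := by
    obtain ⟨y, hy⟩ := he.lift f₀ (K.map (IsFiltered.rightToMax j j₀)).hom (p _)
      (by rw [hf₀, hp])
    exact ⟨(K.map (IsFiltered.leftToMax j j₀)).hom ≫ y, by
      rw [F.map_comp, Category.assoc, hy, hp]⟩
  choose x hx using hx
  let s₀ : Cocone (K ⋙ wideSubcategoryInclusion (M.inverseImage F)) :=
    { pt := X
      ι :=
        { app := x
          naturality := fun i j a => he.ext (by
            change F.map ((K.map a).hom ≫ x j) ≫ e = F.map (x i ≫ 𝟙 X) ≫ e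
            rw [Category.comp_id, F.map_comp, Category.assoc, hx, hx, hp]) } }
  obtain ⟨c, hc, g, hg⟩ := hC.exists_localColimit s₀
  let cι (j : J) : (K.obj j).obj ⟶ c.pt := c.ι.app j
  have hg' (j : J) : cι j ≫ g = x j := hg j
  let α : F.obj c.pt ⟶ P.obj := F.map g ≫ e
  have hα (j : J) : F.map (cι j) ≫ α = p j := by
    rw [← hx j, ← hg' j, F.map_comp, Category.assoc]
  have hleg (j : J) : M.inverseImage F (c.ι.app j) := hcancel (F.map (cι j)) α (by
    rw [hα]
    exact (colimit.ι (K ⋙ F') j).property)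
  let c' : Cocone K := wideCocone c hleg
  let δ : P ⟶ (F'.mapCocone c').pt := colimit.desc (K ⋙ F') (F'.mapCocone c')
  let δ₀ : P.obj ⟶ F.obj c.pt := δ.hom
  have hδ (j : J) : p j ≫ δ₀ = F.map (cι j) :=
    congrArg (fun φ => φ.hom) (colimit.ι_desc (F'.mapCocone c') j)
  have h₁ : α ≫ δ₀ = 𝟙 (F.obj c.pt) := hc.map_ext hF fun j => by
    change F.map (cι j) ≫ α ≫ δ₀ = F.map (cι j) ≫ 𝟙 _
    rw [← Category.assoc, hα, hδ, Category.comp_id]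
  have : Mono δ₀ := hM _ δ.property
  have h₂ : δ₀ ≫ α = 𝟙 P.obj := by
    rw [← cancel_mono δ₀, Category.assoc, h₁, Category.comp_id, Category.id_comp]
  have hαM : M α := hcancel α δ₀ (by
    rw [h₁]
    exact M.id_mem _)
  have hiso : IsIso δ := ⟨⟨α, hαM⟩, WideSubcategory.hom_ext M h₂, WideSubcategory.hom_ext M h₁⟩
  have hiso' : IsIso ((colimit.isColimit (K ⋙ F')).desc (F'.mapCocone c')) := hiso
  have hc' : IsColimit (F'.mapCocone c') := (colimit.isColimit (K ⋙ F')).ofPointIso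
  refine ⟨c', ⟨?_⟩, ⟨hc'⟩⟩
  -- The map `β` induced in `D_M` must be shown to come from `C`. A coreflection `Y` of `F s.pt`
  -- through which `β` factors also receives `s.pt`, by lifting the identity. Hence `c` and `s` are
  -- connected through `Y` as cocones, and the local colimit property applies.
  have key (s : Cocone K) : ∃ g : c'.pt ⟶ s.pt, ∀ j, c'.ι.app j ≫ g = s.ι.app j := by
    let β : F.obj c.pt ⟶ F.obj s.pt.obj := (hc'.desc (F'.mapCocone s)).hom
    let sι (j : J) : (K.obj j).obj ⟶ s.pt.obj := (s.ι.app j).hom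
    have hβ (j : J) : F.map (cι j) ≫ β = F.map (sι j) :=
      congrArg (fun φ => φ.hom) (hc'.fac (F'.mapCocone s) j)
    obtain ⟨Y, e', he', y, hy⟩ := hF.exists_localCoreflection β
    obtain ⟨z, hz⟩ := he'.lift (cι j₀ ≫ y) (sι j₀) (𝟙 _)
      (by rw [F.map_comp, Category.assoc, hy, hβ, Category.comp_id])
    obtain ⟨g, hg⟩ := hc.desc ((wideSubcategoryInclusion _).mapCocone s) y z fun j => he'.ext (by
      change F.map (cι j ≫ y) ≫ e' = F.map (sι j ≫ z) ≫ e'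
      rw [F.map_comp, F.map_comp, Category.assoc, Category.assoc, hy, hz, hβ, Category.comp_id])
    have hg' (j : J) : cι j ≫ g = sι j := hg j
    have hgβ : F.map g = β := hc.map_ext hF fun j => by
      change F.map (cι j) ≫ F.map g = F.map (cι j) ≫ β
      rw [hβ, ← F.map_comp, hg']
      rfl
    refine ⟨⟨g, ?_⟩, fun j => WideSubcategory.hom_ext _ (hg j)⟩
    change M (F.map g)
    rw [hgβ]
    exact (hc'.desc (F'.mapCocone s)).property
  choose desc hdesc using key
  exact
    { desc := desc
      fac := hdesc
      uniq := fun s m hm => WideSubcategory.hom_ext _ (hc.ext fun j =>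
        congrArg (fun φ => φ.hom) ((hm j).trans (hdesc s j).symm)) }

theorem restrict_hasFilteredColimits [HasFilteredColimitsOfSize.{w, w} (WideSubcategory M)] :
    HasFilteredColimitsOfSize.{w, w} (WideSubcategory (M.inverseImage F)) where
  HasColimitsOfShape J _ _ := ⟨fun K => by
    obtain ⟨c, ⟨hc⟩, -⟩ := exists_isColimit_restrictFunctor hC hF hM hcancel K
    exact HasColimit.mk ⟨c, hc⟩⟩

theorem restrict_preservesFilteredColimits
    [HasFilteredColimitsOfSize.{w, w} (WideSubcategory M)] :
    PreservesFilteredColimitsOfSize.{w, w} (restrictFunctor F M) where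
  preserves_filtered_colimits J _ _ := ⟨fun {K} => by
    obtain ⟨c, ⟨hc⟩, ⟨hc'⟩⟩ := exists_isColimit_restrictFunctor hC hF hM hcancel K
    exact preservesColimit_of_preserves_colimit_cocone hc hc'⟩

end

/-! ### Factorisation systems and accessibility -/

section

variable {C : Type u₁} [Category.{v₁} C] {E M : MorphismProperty C} [M.IsMultiplicative]
  (hEM : IsFactorisationSystem E M) (hM : M ≤ MorphismProperty.monomorphisms C)
  (hcancel : ∀ {X Y Z : C} (f : X ⟶ Y) (g : Y ⟶ Z), M (f ≫ g) → M f)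
  (κ : Cardinal.{w}) [Fact κ.IsRegular] [(wideSubcategoryInclusion M).IsCardinalAccessible κ]

include hEM hM hcancel

/-- `E`-quotients of `κ`-presentable objects are `κ`-presentable in the category of morphisms
in `M`. -/
theorem isCardinalPresentable_of_quotient {G I : C} [IsCardinalPresentable G κ] (e : G ⟶ I)
    (he : E e) : IsCardinalPresentable (⟨I⟩ : WideSubcategory M) κ := by
  have := WideSubcategory.allMono M hM
  refine AllMono.isCardinalPresentable_of_lift _ κ fun J _ _ F c hc f => ?_
  have := (wideSubcategoryInclusion M).preservesColimitsOfShape_of_isCardinalAccessible κ J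
  obtain ⟨j, g, hg⟩ : ∃ (j : J) (g : G ⟶ (F.obj j).obj), g ≫ (c.ι.app j).hom = e ≫ f.hom :=
    IsCardinalPresentable.exists_hom_of_isColimit κ
      (isColimitOfPreserves (wideSubcategoryInclusion M) hc) (e ≫ f.hom)
  obtain ⟨d, ⟨-, hd⟩, -⟩ := hEM.lifts e (c.ι.app j).hom g f.hom he (c.ι.app j).property hg
  refine ⟨j, ⟨d, hcancel d (c.ι.app j).hom ?_⟩, WideSubcategory.hom_ext M hd⟩
  rw [hd]
  exact f.property

/-- Small subobjects are the `E`-quotients of presentable objects. Fewer than `κ` of them lie in the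
image of one presentable object, by bounding their covers and filling diagonals. They detect
isomorphisms because each stage of a presentation of `X` factors through its image. -/
theorem wideSubcategory_isCardinalAccessible [IsCardinalAccessibleCategory C κ]
    [HasFilteredColimitsOfSize.{w, w} (WideSubcategory M)]
    [ObjectProperty.EssentiallySmall.{w} fun X : WideSubcategory M =>
      ∃ (G : C) (_ : IsCardinalPresentable G κ) (e : G ⟶ X.obj), E e] :
    IsCardinalAccessibleCategory (WideSubcategory M) κ := by
  have := WideSubcategory.allMono M hM
  refine isCardinalAccessible_of_generator
    (P := fun X => ∃ (G : C) (_ : IsCardinalPresentable G κ) (e : G ⟶ X.obj), E e)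
    (AllMono.isCardinalFilteredGenerator_of_subobjects κ _ ?_ ?_ ?_)
  · rintro X ⟨G, _, e, he⟩
    exact isCardinalPresentable_of_quotient hEM hM hcancel κ e he
  · intro X ι hι p hp f
    choose G hG e he using hp
    obtain ⟨H, hH, h, hh⟩ := exists_presentable_bound hι hG fun i => e i ≫ (f i).hom
    obtain ⟨Z, e₀, m, he₀, hm, rfl⟩ := hEM.factors h
    refine ⟨⟨Z⟩, ⟨H, hH, e₀, he₀⟩, ⟨m, hm⟩, fun i => ?_⟩
    obtain ⟨a, ha⟩ := hh i
    obtain ⟨d, ⟨-, hd⟩, -⟩ := hEM.lifts (e i) m (a ≫ e₀) (f i).hom (he i) hm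
      (by rw [Category.assoc, ha])
    refine ⟨⟨d, hcancel d m ?_⟩, WideSubcategory.hom_ext M hd⟩
    rw [hd]
    exact (f i).property
  · intro Z X m hm
    obtain ⟨J, _, _, ⟨c⟩⟩ := exists_colimitOfShape_presentable κ X.obj
    have : Mono m.hom := hM _ m.property
    obtain ⟨s, hs⟩ := exists_lift_of_isColimit c.isColimit (𝟙 X.obj) m.hom fun j => by
      obtain ⟨I, e, n, he, hn, hen⟩ := hEM.factors (c.ι.app j)
      obtain ⟨a, ha⟩ := hm ⟨I⟩ ⟨_, c.prop_diag_obj j, e, he⟩ ⟨n, hn⟩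
      have ha' : a.hom ≫ m.hom = n := congrArg (fun φ => φ.hom) ha
      refine ⟨e ≫ a.hom, ?_⟩
      rw [Category.assoc, ha', hen]
      exact (Category.comp_id _).symm
    have hsM : M s := hcancel s m.hom (by
      rw [hs]
      exact M.id_mem _)
    exact AllMono.isIso_of_section m ⟨s, hsM⟩ (WideSubcategory.hom_ext M hs)

end

section

variable {D : Type u₂} [Category.{v₂} D] {E M : MorphismProperty D} [M.IsMultiplicative]
  (hEM : IsFactorisationSystem E M) (hM : M ≤ MorphismProperty.monomorphisms D)
  (hcancel : ∀ {X Y Z : D} (f : X ⟶ Y) (g : Y ⟶ Z), M (f ≫ g) → M f)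
  [HasFilteredColimitsOfSize.{w, w} (WideSubcategory M)]

include hM hcancel in
theorem wideSubcategoryInclusion_isCardinalAccessible (κ : Cardinal.{w}) [Fact κ.IsRegular]
    [HasCardinalFilteredColimits.{w} D κ] :
    (wideSubcategoryInclusion M).IsCardinalAccessible κ where
  preservesColimitOfShape J _ _ := by
    have := isFiltered_of_isCardinalFiltered J κ
    have := HasCardinalFilteredColimits.hasColimitsOfShape (κ := κ) D J
    exact preservesColimitsOfShape_wideSubcategoryInclusion hM hcancel

include hEM hM hcancel

/-- The `E`-quotients of an object form an essentially small class. -/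
theorem essentiallySmall_quotients [IsAccessibleCategory.{w} D]
    [IsAccessibleCategory.{w} (WideSubcategory M)] (Y : D) :
    ObjectProperty.EssentiallySmall.{w} fun X : WideSubcategory M => ∃ e : Y ⟶ X.obj, E e := by
  have := WideSubcategory.allMono M hM
  obtain ⟨κ₁, _, _⟩ := IsAccessibleCategory.exists_cardinal.{w} D
  obtain ⟨κ₂, _, _⟩ := IsAccessibleCategory.exists_cardinal.{w} (WideSubcategory M)
  obtain ⟨κ₃, _, h₃⟩ := (inferInstance : IsPresentable.{w} Y).exists_cardinal
  obtain ⟨κ, hκ, hle⟩ := exists_regular_bound.{w} (fun i : Fin 3 => ![κ₁, κ₂, κ₃] i)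
  have hle₁ : κ₁ ≤ κ := hle 0
  have hle₂ : κ₂ ≤ κ := hle 1
  have hle₃ : κ₃ ≤ κ := hle 2
  have : Fact κ.IsRegular := ⟨hκ⟩
  -- Accessibility of `D` at this `κ` is not needed, only its `κ`-filtered colimits. `D_M` is
  -- `κ`-accessible because its index may be raised freely, so its `κ`-presentable objects are
  -- essentially small.
  have : HasCardinalFilteredColimits.{w} D κ := ⟨fun J _ _ => by
    have := IsCardinalFiltered.of_le J hle₁
    exact HasCardinalFilteredColimits.hasColimitsOfShape (κ := κ₁) D J⟩
  have := wideSubcategoryInclusion_isCardinalAccessible hM hcancel κ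
  have : IsCardinalPresentable Y κ₃ := h₃
  have : IsCardinalPresentable Y κ := isCardinalPresentable_of_le Y hle₃
  have := (AllMono.isCardinalAccessible_of_le (K := WideSubcategory M) hle₂).1
  exact .of_le (Q := isCardinalPresentable (WideSubcategory M) κ) fun X ⟨e, he⟩ =>
    isCardinalPresentable_of_quotient hEM hM hcancel κ e he

end

theorem inverseImage_le_monomorphisms {C : Type u₁} [Category.{v₁} C] {D : Type u₂}
    [Category.{v₂} D] {F : C ⥤ D} [F.Faithful] {M : MorphismProperty D}
    (hM : M ≤ MorphismProperty.monomorphisms D) :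
    M.inverseImage F ≤ MorphismProperty.monomorphisms C := fun _ _ f hf =>
  have : Mono (F.map f) := hM _ hf
  F.mono_of_mono_map this

theorem inverseImage_cancel {C : Type u₁} [Category.{v₁} C] {D : Type u₂} [Category.{v₂} D]
    {F : C ⥤ D} {M : MorphismProperty D}
    (hcancel : ∀ {X Y Z : D} (f : X ⟶ Y) (g : Y ⟶ Z), M (f ≫ g) → M f) {X Y Z : C} (f : X ⟶ Y)
    (g : Y ⟶ Z) (h : M.inverseImage F (f ≫ g)) : M.inverseImage F f :=
  hcancel (F.map f) (F.map g) (by rwa [← F.map_comp])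

section

variable {C : Type u₁} [Category.{v₁} C] {D : Type u₂} [Category.{v₂} D]
  {F : C ⥤ D} [F.Faithful] (hF : IsLeftMultiadjoint.{w} F)
  {E M : MorphismProperty D} [M.IsMultiplicative]
  (hEM : IsFactorisationSystem E M)
  (hM : M ≤ MorphismProperty.monomorphisms D)
  (hcancel : ∀ {X Y Z : D} (f : X ⟶ Y) (g : Y ⟶ Z), M (f ≫ g) → M f)
  (hPre : IsFactorisationSystem (E.inverseImage F) (M.inverseImage F))

include hF hM hcancel hPre in
/-- Quotients in `C` are determined by their images in `D`. -/
theorem nonempty_iso_of_quotients {G : C} {I I' : WideSubcategory (M.inverseImage F)}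
    (e : G ⟶ I.obj) (e' : G ⟶ I'.obj) (he : E (F.map e)) (he' : E (F.map e'))
    (ψ : F.obj I.obj ⟶ F.obj I'.obj) (hψ : M ψ) (w : F.map e ≫ ψ = F.map e') :
    Nonempty (I ≅ I') := by
  have := WideSubcategory.allMono _ (inverseImage_le_monomorphisms (F := F) hM)
  -- `ψ` need not be the image of a morphism of `C`. Coreflecting the identity of `F I'` gives a `Y`
  -- into which `I` and `I'` both map by `M`-morphisms, with the same composite from `G`; uniqueness
  -- of factorisations then identifies `I` and `I'`.
  obtain ⟨Y, ε, hε, y', hy'⟩ := hF.exists_localCoreflection (𝟙 (F.obj I'.obj))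
  obtain ⟨y, hy, hey⟩ := hε.lift_comp (e' ≫ y') e ψ
    (by rw [F.map_comp, Category.assoc, hy', w, Category.comp_id])
  have hMy : M (F.map y) := hcancel _ ε (by rwa [hy])
  have hMy' : M (F.map y') := hcancel _ ε (by
    rw [hy']
    exact M.id_mem _)
  obtain ⟨d, ⟨-, hd⟩, -⟩ := hPre.lifts e y' e' y he hMy' hey.symm
  obtain ⟨d', ⟨-, hd'⟩, -⟩ := hPre.lifts e' y e y' he' hMy hey
  have hMd : M.inverseImage F d := inverseImage_cancel hcancel d y' (by rwa [hd])
  have hMd' : M.inverseImage F d' := inverseImage_cancel hcancel d' y (by rwa [hd'])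
  have : Mono y := inverseImage_le_monomorphisms (F := F) hM _ hMy
  have : Mono y' := inverseImage_le_monomorphisms (F := F) hM _ hMy'
  exact ⟨WideSubcategory.isoMk
    ⟨d, d', by rw [← cancel_mono y, Category.assoc, hd', hd, Category.id_comp],
      by rw [← cancel_mono y', Category.assoc, hd, hd', Category.id_comp]⟩ hMd hMd'⟩

variable [HasFilteredColimitsOfSize.{w, w} (WideSubcategory M)] [IsAccessibleCategory.{w} D]
  [IsAccessibleCategory.{w} (WideSubcategory M)]

include hF hEM hM hcancel hPre

/-- A quotient `X` of `G` is encoded by a representative of the isomorphism class of `F X` with the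
induced map from `F G`. These data form a small set, and by `nonempty_iso_of_quotients` they
determine `X` up to isomorphism. -/
theorem essentiallySmall_quotients_restrict (G : C) :
    ObjectProperty.EssentiallySmall.{w} fun X : WideSubcategory (M.inverseImage F) =>
      ∃ e : G ⟶ X.obj, E (F.map e) := by
  have := essentiallySmall_quotients hEM hM hcancel (F.obj G)
  obtain ⟨Q, _, -, hQ⟩ := ObjectProperty.EssentiallySmall.exists_small_le.{w}
    fun X : WideSubcategory M => ∃ e : F.obj G ⟶ X.obj, E e
  obtain ⟨κ, _, _⟩ := IsAccessibleCategory.exists_cardinal.{w} D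
  have hloc : LocallySmall.{w} D := inferInstance
  let T := Σ q : Subtype Q, (F.obj G ⟶ q.1.obj)
  let R (t : T) (X : WideSubcategory (M.inverseImage F)) : Prop :=
    ∃ (e : G ⟶ X.obj) (φ : F.obj X.obj ⟶ t.1.1.obj) (_ : E (F.map e)) (_ : M φ)
      (φ' : t.1.1.obj ⟶ F.obj X.obj) (_ : M φ') (_ : φ ≫ φ' = 𝟙 _), F.map e ≫ φ = t.2
  refine essentiallySmall_of_family (T := { t : T // ∃ X, R t X }) (fun t => t.2.choose) ?_
  rintro X ⟨e, he⟩
  obtain ⟨q, hq, ⟨i⟩⟩ := hQ ⟨F.obj X.obj⟩ ⟨F.map e, he⟩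
  let t : T := ⟨⟨q, hq⟩, F.map e ≫ i.hom.hom⟩
  have ht : ∃ X, R t X := ⟨X, e, i.hom.hom, he, i.hom.property, i.inv.hom, i.inv.property,
    congrArg (fun φ => φ.hom) i.hom_inv_id, rfl⟩
  obtain ⟨e₀, φ, he₀, -, φ', hφ', hφφ', hw⟩ := ht.choose_spec
  refine ⟨⟨t, ht⟩, nonempty_iso_of_quotients hF hM hcancel hPre e e₀ he he₀ (i.hom.hom ≫ φ')
    (M.comp_mem _ _ i.hom.property hφ') ?_⟩
  have hw' : F.map e ≫ i.hom.hom = F.map e₀ ≫ φ := hw.symm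
  rw [← Category.assoc]
  refine (congrArg (· ≫ φ') hw').trans ?_
  exact (Category.assoc _ _ _).trans ((congrArg (F.map e₀ ≫ ·) hφφ').trans (Category.comp_id _))

theorem restrict_isAccessible [IsAccessibleCategory.{w} C] (hC : IsMulticocomplete.{w} C) :
    IsAccessibleCategory.{w} (WideSubcategory (M.inverseImage F)) := by
  obtain ⟨κ, _, _⟩ := IsAccessibleCategory.exists_cardinal.{w} C
  have hM' := inverseImage_le_monomorphisms (F := F) hM
  have hcancel' : ∀ {X Y Z : C} (f : X ⟶ Y) (g : Y ⟶ Z), _ → _ :=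
    inverseImage_cancel (F := F) hcancel
  have := restrict_hasFilteredColimits hC hF hM hcancel
  have := wideSubcategoryInclusion_isCardinalAccessible hM' hcancel' κ
  obtain ⟨Q, _, -, hQ⟩ :=
    ObjectProperty.EssentiallySmall.exists_small_le.{w} (isCardinalPresentable C κ)
  have hsmall (q : Subtype Q) := essentiallySmall_quotients_restrict hF hEM hM hcancel hPre q.1
  have : ObjectProperty.EssentiallySmall.{w} fun X : WideSubcategory (M.inverseImage F) =>
      ∃ (G : C) (_ : IsCardinalPresentable G κ) (e : G ⟶ X.obj), E.inverseImage F e := by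
    refine .of_le (Q := ⨆ q : Subtype Q, fun X : WideSubcategory (M.inverseImage F) =>
      ∃ e : q.1 ⟶ X.obj, E (F.map e)) ?_
    rintro X ⟨G, hG, e, he⟩
    obtain ⟨q, hq, ⟨i⟩⟩ := hQ _ hG
    simp only [iSup_apply, iSup_Prop_eq]
    exact ⟨⟨q, hq⟩, i.inv ≫ e, hPre.left_comp _ _ (hPre.left_iso _ (.infer_property _)) he⟩
  exact ⟨κ, inferInstance, wideSubcategory_isCardinalAccessible hPre hM' hcancel' κ⟩

end

/-! ### Colimits in arrow categories -/

theorem preservesColimitsOfShape_mapArrow {X : Type u₁} [Category.{v₁} X] {Y : Type u₂}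
    [Category.{v₂} Y] (G : X ⥤ Y) {J : Type u} [Category.{v} J] [HasColimitsOfShape J X]
    [PreservesColimitsOfShape J G] : PreservesColimitsOfShape J G.mapArrow where
  preservesColimit {K} := by
    let t₁ := colimit.isColimit (K ⋙ Comma.fst (𝟭 X) (𝟭 X))
    let t₂ := colimit.isColimit (K ⋙ Comma.snd (𝟭 X) (𝟭 X))
    let hc := Comma.coconeOfPreservesIsColimit K t₁ t₂
    exact preservesColimit_of_preserves_colimit_cocone hc
      (Comma.fstSndJointlyReflectColimit (isColimitOfPreserves G t₁) (isColimitOfPreserves G t₂))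

theorem preservesFilteredColimits_mapArrow {X : Type u₁} [Category.{v₁} X] {Y : Type u₂}
    [Category.{v₂} Y] (G : X ⥤ Y) [HasFilteredColimitsOfSize.{w, w} X]
    [PreservesFilteredColimitsOfSize.{w, w} G] :
    PreservesFilteredColimitsOfSize.{w, w} G.mapArrow where
  preserves_filtered_colimits J _ _ :=
    have := PreservesFilteredColimitsOfSize.preserves_filtered_colimits (F := G) J
    preservesColimitsOfShape_mapArrow G

/-! ### Directed colimits of the base category and left cancellation of independent squares -/

namespace IndependenceRelation

section

variable {X : Type u} [Category.{v} X] {R : IndependenceRelation X}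
  (h₁ : R.BasicExistence) (h₂ : R.Transitivity)

/-- The functor sending an object to its identity, viewed as an arrow. -/
def identityArrow : X ⥤ R.IndepArrow h₁ h₂ :=
  haveI := isMultiplicative_squares h₁ h₂
  { obj := fun x => ⟨Arrow.mk (𝟙 x)⟩
    map := fun {x y} f => ⟨Arrow.homMk (f := Arrow.mk (𝟙 x)) (g := Arrow.mk (𝟙 y)) f f (by simp),
      h₁ _ _ _ _ (by simp) (Or.inr (inferInstanceAs (IsIso (𝟙 x))))⟩
    map_id := fun _ => rfl
    map_comp := fun _ _ => rfl }

include h₁ h₂ in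
/-- A category with a relation whose independent squares are closed under directed colimits has
directed colimits. -/
theorem Union.hasDirectedColimits (h : Union.{w} R h₁ h₂) : HasDirectedColimits.{w} X := by
  intro J _ _ _
  have := h.1 J
  have := h.2 J
  refine ⟨fun K => ?_⟩
  -- Squares between identity arrows are independent, so `K` embeds in the category of independent
  -- squares. The codomain of the colimit arrow is the colimit of `K`.
  let K' : J ⥤ R.IndepArrow h₁ h₂ := K ⋙ identityArrow h₁ h₂
  let c : Cocone (K' ⋙ R.indepArrowInclusion h₁ h₂) :=
    (R.indepArrowInclusion h₁ h₂).mapCocone (colimit.cocone K')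
  let hc : IsColimit c := isColimitOfPreserves _ (colimit.isColimit K')
  let q (j : J) : K.obj j ⟶ c.pt.right := (c.ι.app j).right
  let p (j : J) : K.obj j ⟶ c.pt.left := (c.ι.app j).left
  have hpq (j : J) : p j ≫ c.pt.hom = q j := (Arrow.w (c.ι.app j)).trans (Category.id_comp _)
  have hq {i j : J} (a : i ⟶ j) : K.map a ≫ q j = q i :=
    congrArg (fun φ => φ.right) (c.w a)
  let c' : Cocone K :=
    { pt := c.pt.right
      ι := { app := q, naturality := fun i j a => (hq a).trans (Category.comp_id _).symm } }
  let s' (s : Cocone K) : Cocone (K' ⋙ R.indepArrowInclusion h₁ h₂) :=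
    { pt := Arrow.mk (𝟙 s.pt)
      ι :=
        { app := fun j => Arrow.homMk (u := s.ι.app j) (v := s.ι.app j)
            ((Category.comp_id _).trans (Category.id_comp _).symm : s.ι.app j ≫ 𝟙 s.pt = 𝟙 _ ≫ s.ι.app j)
          naturality := fun i j a => by
            ext
            · exact (s.w a).trans (Category.comp_id _).symm
            · exact (s.w a).trans (Category.comp_id _).symm } }
  refine HasColimit.mk ⟨c',
    { desc := fun s => (hc.desc (s' s)).right
      fac := fun s j => congrArg (fun φ => φ.right) (hc.fac (s' s) j)
      uniq := fun s m hm => ?_ }⟩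
  -- A competitor `m` extends to a morphism of arrows with left component `c.pt.hom ≫ m`, so
  -- uniqueness in the arrow category applies.
  have e : Arrow.homMk (f := c.pt) (g := (s' s).pt) (c.pt.hom ≫ m) m (Category.comp_id _) =
      hc.desc (s' s) := hc.uniq (s' s) _ fun j => by
    have hm' : q j ≫ m = s.ι.app j := hm j
    ext
    · change p j ≫ c.pt.hom ≫ m = s.ι.app j
      rw [← Category.assoc, hpq, hm']
    · exact hm'
  exact congrArg (fun φ => φ.right) e

/-- Monotonicity drops `ψ.left` and invariance strips `ψ.right`. This supplies the left
cancellability required by `wide_pullback_isAccessible`. -/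
theorem squares_of_comp (hmon : R.Monotonicity) (hinv : R.Invariance)
    {f g h : Arrow X} (φ : f ⟶ g) (ψ : g ⟶ h) (H : R.squares (φ ≫ ψ)) : R.squares φ := by
  have H' : R.Indep f.hom (φ.left ≫ ψ.left) (φ.right ≫ ψ.right) h.hom := H
  have := hmon _ _ _ _ _ H'
  rw [Arrow.w ψ] at this
  exact (hinv _ _ _ _ ψ.right (Arrow.w φ).symm).2 this

theorem squares_of_isIso (h₁ : R.BasicExistence) {f g : Arrow X} (φ : f ⟶ g) [IsIso φ] :
    R.squares φ :=
  h₁ _ _ _ _ (Arrow.w φ).symm (Or.inl inferInstance)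

end

end IndependenceRelation

namespace IndependenceRelation

/-! ### Semi-invariance -/

section

variable {D : Type u₂} [Category.{v₂} D] {M : MorphismProperty D} [M.IsMultiplicative]
  {R : IndependenceRelation (WideSubcategory M)} (hSemi : R.toAmbient.SemiInvariance)

include hSemi

/-- Apply semi-invariance to the square with two identities and two copies of `f`. Its extension
along `g` is independent by basic existence, and independent squares consist of morphisms in `M`. -/
theorem SemiInvariance.left_cancel (h₁ : R.BasicExistence) {X Y Z : D} (f : X ⟶ Y) (g : Y ⟶ Z)
    (h : M (f ≫ g)) : M f := by
  let k : (⟨X⟩ : WideSubcategory M) ⟶ ⟨Z⟩ := ⟨f ≫ g, h⟩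
  obtain ⟨-, -, hf, -⟩ := hSemi (𝟙 X) (𝟙 X) f f g rfl
    ⟨M.id_mem X, M.id_mem X, h, h, h₁ (𝟙 _) (𝟙 _) k k rfl (Or.inl inferInstance)⟩
  exact hf

/-- Unlike in invariance, `de` is not required to lie in `M`. It is used with `de` a coreflection
map `F X ⟶ N`. -/
theorem SemiInvariance.indep_of_fac {c a b d e : WideSubcategory M} {ca : c ⟶ a} {cb : c ⟶ b}
    {ad : a ⟶ d} {bd : b ⟶ d} {ae : a ⟶ e} {be : b ⟶ e} (de : d.obj ⟶ e.obj)
    (hw : ca.hom ≫ ad.hom = cb.hom ≫ bd.hom) (ha : ad.hom ≫ de = ae.hom)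
    (hb : bd.hom ≫ de = be.hom) (h : R.Indep ca cb ae be) : R.Indep ca cb ad bd := by
  obtain ⟨_, _, _, _, h'⟩ := hSemi ca.hom cb.hom ad.hom bd.hom de hw (by
    rw [ha, hb]
    exact ⟨ca.property, cb.property, ae.property, be.property, h⟩)
  exact h'

end

/-! ### Lifting the properties of an independence relation -/

section

variable {C : Type u₁} [Category.{v₁} C] {D : Type u₂} [Category.{v₂} D]
  {R : IndependenceRelation D} (F : C ⥤ D)

theorem Invariance.lift (h : R.Invariance) : (R.lift F).Invariance := by
  intro c a b m n ca cb am bm mn hw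
  have hi := h (F.map ca) (F.map cb) (F.map am) (F.map bm) (F.map mn)
    (by rw [← F.map_comp, ← F.map_comp, hw])
  rw [← F.map_comp, ← F.map_comp] at hi
  exact ⟨fun h' => ⟨by rw [← Category.assoc, hw, Category.assoc], hi.1 h'.2⟩,
    fun h' => ⟨hw, hi.2 h'.2⟩⟩

theorem Monotonicity.lift (h : R.Monotonicity) : (R.lift F).Monotonicity := by
  rintro c a b' b m ca cb' b'b am bm ⟨hw, hi⟩
  rw [F.map_comp] at hi
  refine ⟨by rw [hw, Category.assoc], ?_⟩
  rw [F.map_comp]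
  exact h _ _ _ _ _ hi

theorem Transitivity.lift (h : R.Transitivity) : (R.lift F).Transitivity := by
  rintro c a b m d n ca cb am bm bd mn dn ⟨hw, hi⟩ ⟨hw', hi'⟩
  refine ⟨by rw [← Category.assoc, hw, Category.assoc, hw', Category.assoc], ?_⟩
  rw [F.map_comp, F.map_comp]
  exact h _ _ _ _ _ _ _ hi hi'

theorem Symmetry.lift (h : R.Symmetry) : (R.lift F).Symmetry := fun _ _ _ _ =>
  ⟨fun h' => ⟨h'.1.symm, (h _ _ _ _).1 h'.2⟩, fun h' => ⟨h'.1.symm, (h _ _ _ _).2 h'.2⟩⟩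

end

section

variable {C : Type u₁} [Category.{v₁} C] {D : Type u₂} [Category.{v₂} D]
  {F : C ⥤ D} (hF : IsLeftMultiadjoint.{w} F) {M : MorphismProperty D} [M.IsMultiplicative]
  {R : IndependenceRelation (WideSubcategory M)} (hSemi : R.toAmbient.SemiInvariance)

include hF hSemi

theorem Existence.lift_restrictFunctor (h₁ : R.BasicExistence) (h : R.Existence) :
    (R.lift (restrictFunctor F M)).Existence := by
  intro c a b ca cb
  let F' := restrictFunctor F M
  obtain ⟨N, am, bm, hN⟩ := h (F'.map ca) (F'.map cb)
  have hw : F.map ca.hom ≫ am.hom = F.map cb.hom ≫ bm.hom :=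
    congrArg (fun φ => φ.hom) (R.comm hN)
  obtain ⟨X, e, he, x, hx⟩ :
      ∃ (X : C) (e : F.obj X ⟶ N.obj) (_ : IsLocalCoreflection F e) (x : a.obj ⟶ X),
        F.map x ≫ e = am.hom := hF.exists_localCoreflection _
  obtain ⟨y, hy, hxy⟩ := he.lift_comp (ca.hom ≫ x) cb.hom bm.hom
    (by rw [F.map_comp, Category.assoc, hx, hw])
  have hcancel := @SemiInvariance.left_cancel _ _ _ _ _ hSemi h₁
  have hMx : M (F.map x) := hcancel _ e (by
    rw [hx]
    exact am.property)
  have hMy : M (F.map y) := hcancel _ e (by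
    rw [hy]
    exact bm.property)
  refine ⟨⟨X⟩, ⟨x, hMx⟩, ⟨y, hMy⟩, WideSubcategory.hom_ext _ hxy.symm, ?_⟩
  refine SemiInvariance.indep_of_fac hSemi e ?_ hx hy hN
  change F.map ca.hom ≫ F.map x = F.map cb.hom ≫ F.map y
  rw [← F.map_comp, ← F.map_comp, hxy]

theorem ThreeAmalgamation.lift_restrictFunctor (h₁ : R.BasicExistence) (h : R.ThreeAmalgamation) :
    (R.lift (restrictFunctor F M)).ThreeAmalgamation := by
  rintro m a b c n₁ n₂ n₃ ma mb mc an₁ bn₁ an₂ cn₂ bn₃ cn₃ ⟨w₁, i₁⟩ ⟨w₂, i₂⟩ ⟨w₃, i₃⟩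
  let F' := restrictFunctor F M
  obtain ⟨N, p₁, p₂, p₃, ha, hb, hc, hN⟩ := h _ _ _ _ _ _ _ _ _ i₁ i₂ i₃
  replace ha : F.map an₁.hom ≫ p₁.hom = F.map an₂.hom ≫ p₂.hom :=
    congrArg (fun φ => φ.hom) ha
  replace hb : F.map bn₁.hom ≫ p₁.hom = F.map bn₃.hom ≫ p₃.hom :=
    congrArg (fun φ => φ.hom) hb
  replace hc : F.map cn₂.hom ≫ p₂.hom = F.map cn₃.hom ≫ p₃.hom :=
    congrArg (fun φ => φ.hom) hc
  -- Coreflect along `p₃`; then `b` and `c` link `n₁` and `n₂` to `n₃`, so `p₁` and `p₂` lift to the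
  -- same `X`. The face over `a` commutes because `e` separates maps into `X`.
  obtain ⟨X, e, he, x₃, hx₃⟩ :
      ∃ (X : C) (e : F.obj X ⟶ N.obj) (_ : IsLocalCoreflection F e) (x : n₃.obj ⟶ X),
        F.map x ≫ e = p₃.hom := hF.exists_localCoreflection _
  obtain ⟨x₁, hx₁, hb'⟩ := he.lift_comp (bn₃.hom ≫ x₃) bn₁.hom p₁.hom
    (by rw [F.map_comp, Category.assoc, hx₃, hb])
  obtain ⟨x₂, hx₂, hc'⟩ := he.lift_comp (cn₃.hom ≫ x₃) cn₂.hom p₂.hom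
    (by rw [F.map_comp, Category.assoc, hx₃, hc])
  have ha' : an₁.hom ≫ x₁ = an₂.hom ≫ x₂ := he.ext (by
    rw [F.map_comp, F.map_comp, Category.assoc, Category.assoc, hx₁, hx₂, ha])
  have hcancel := @SemiInvariance.left_cancel _ _ _ _ _ hSemi h₁
  have hM₁ : M (F.map x₁) := hcancel _ e (by
    rw [hx₁]
    exact p₁.property)
  have hM₂ : M (F.map x₂) := hcancel _ e (by
    rw [hx₂]
    exact p₂.property)
  have hM₃ : M (F.map x₃) := hcancel _ e (by
    rw [hx₃]
    exact p₃.property)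
  have w₁' : ma.hom ≫ an₁.hom = mb.hom ≫ bn₁.hom := congrArg (fun φ => φ.hom) w₁
  have hw : ma.hom ≫ an₁.hom ≫ x₁ = (mb.hom ≫ bn₃.hom) ≫ x₃ := by
    rw [reassoc_of% w₁', hb', Category.assoc]
  refine ⟨⟨X⟩, ⟨x₁, hM₁⟩, ⟨x₂, hM₂⟩, ⟨x₃, hM₃⟩, WideSubcategory.hom_ext _ ha',
    WideSubcategory.hom_ext _ hb', WideSubcategory.hom_ext _ hc', WideSubcategory.hom_ext _ hw, ?_⟩
  rw [F'.map_comp]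
  refine SemiInvariance.indep_of_fac hSemi e ?_ ?_ hx₃ hN
  · change F.map ma.hom ≫ F.map (an₁.hom ≫ x₁) = (F.map mb.hom ≫ F.map bn₃.hom) ≫ F.map x₃
    rw [← F.map_comp, ← F.map_comp, ← F.map_comp, hw]
  · change F.map (an₁.hom ≫ x₁) ≫ e = F.map an₁.hom ≫ p₁.hom
    rw [F.map_comp, Category.assoc, hx₁]

end

/-! ### Base monotonicity -/

/-- In a multicocomplete category, a commuting square factors through a member of the
multipushout of its span. -/
theorem _root_.CatIndep.IsMulticocomplete.exists_localPushout {C : Type u} [Category.{v} C]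
    (hC : IsMulticocomplete.{w} C) {c a b m : C} (ca : c ⟶ a) (cb : c ⟶ b) (am : a ⟶ m)
    (bm : b ⟶ m) (hw : ca ≫ am = cb ≫ bm) :
    ∃ (p : C) (ap : a ⟶ p) (bp : b ⟶ p) (pm : p ⟶ m), ca ≫ ap = cb ≫ bp ∧ ap ≫ pm = am ∧
      bp ≫ pm = bm ∧
      (∀ {z : C} {g h : p ⟶ z}, ap ≫ g = ap ≫ h → bp ≫ g = bp ≫ h → g = h) ∧
      ∀ {n z : C} (an : a ⟶ n) (bn : b ⟶ n) (nz : n ⟶ z) (mz : m ⟶ z), ca ≫ an = cb ≫ bn →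
        am ≫ mz = an ≫ nz → bm ≫ mz = bn ≫ nz → ∃ g : p ⟶ n, ap ≫ g = an ∧ bp ≫ g = bn := by
  let K : AsSmall.{w} WalkingSpan ⥤ C := AsSmall.down ⋙ span ca cb
  let s {n : C} (an : a ⟶ n) (bn : b ⟶ n) (h : ca ≫ an = cb ≫ bn) : Cocone K :=
    (PushoutCocone.mk an bn h).whisker AsSmall.down
  obtain ⟨P, hP, g, hg⟩ : ∃ (P : Cocone K) (_ : IsLocalColimit P) (g : P.pt ⟶ m),
      ∀ j, P.ι.app j ≫ g = (s am bm hw).ι.app j := hC.exists_localColimit (s am bm hw)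
  let l : AsSmall.{w} WalkingSpan := AsSmall.up.obj WalkingSpan.left
  let r : AsSmall.{w} WalkingSpan := AsSmall.up.obj WalkingSpan.right
  let o : AsSmall.{w} WalkingSpan := AsSmall.up.obj WalkingSpan.zero
  let ap : a ⟶ P.pt := P.ι.app l
  let bp : b ⟶ P.pt := P.ι.app r
  let cp : c ⟶ P.pt := P.ι.app o
  have hl : ca ≫ ap = cp := P.w (AsSmall.up.map WalkingSpan.Hom.fst : o ⟶ l)
  have hr : cb ≫ bp = cp := P.w (AsSmall.up.map WalkingSpan.Hom.snd : o ⟶ r)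
  have hap : ap ≫ g = am := hg l
  have hbp : bp ≫ g = bm := hg r
  refine ⟨P.pt, ap, bp, g, hl.trans hr.symm, hap, hbp, fun {z g h} h₁ h₂ => hP.ext ?_, ?_⟩
  · rintro ⟨_ | _ | _⟩
    · change cp ≫ g = cp ≫ h
      rw [← hl, Category.assoc, Category.assoc, h₁]
    · exact h₁
    · exact h₂
  · intro n z an bn nz mz hn h₁ h₂
    obtain ⟨k, hk⟩ := hP.desc (s an bn hn) (g ≫ mz) nz (by
      rintro ⟨_ | _ | _⟩
      · change cp ≫ g ≫ mz = (ca ≫ an) ≫ nz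
        rw [← hl, Category.assoc, reassoc_of% hap, h₁, Category.assoc]
      · change ap ≫ g ≫ mz = an ≫ nz
        rw [reassoc_of% hap, h₁]
      · change bp ≫ g ≫ mz = bn ≫ nz
        rw [reassoc_of% hbp, h₂])
    exact ⟨k, hk l, hk r⟩

section

variable {C : Type u₁} [Category.{v₁} C] {D : Type u₂} [Category.{v₂} D]
  {F : C ⥤ D} (hF : IsLeftMultiadjoint.{w} F) {E M : MorphismProperty D} [M.IsMultiplicative]
  (hEM : IsFactorisationSystem E M)
  (hPre : IsFactorisationSystem (E.inverseImage F) (M.inverseImage F))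
  (hcancel : ∀ {X Y Z : D} (f : X ⟶ Y) (g : Y ⟶ Z), M (f ≫ g) → M f)
  (hC : IsMulticocomplete.{w} C)
  {R : IndependenceRelation (WideSubcategory M)}

include hF hEM hPre hcancel hC

/-- The witness for `a'` is the image `I` in `m` of a local pushout of `a` and `b` over `c`, and no
extension of `m` is needed. `I` is small enough for `F I` to map into the object `A` given in `D_M`.
-/
theorem BaseMonotonicity.lift_restrictFunctor (hinv : R.Invariance) (hmon : R.Monotonicity)
    (hsym : R.Symmetry) (h : R.BaseMonotonicity) :
    (R.lift (restrictFunctor F M)).BaseMonotonicity := by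
  rintro c a b d m ca cb bd am dm ⟨hw, hi⟩
  let F' := restrictFunctor F M
  rw [F'.map_comp] at hi
  obtain ⟨A, N, aA, bA, An, mn, h₁, h₂, h₃, hN⟩ := h _ _ _ _ _ hi
  have hw' : ca.hom ≫ am.hom = cb.hom ≫ bd.hom ≫ dm.hom :=
    (congrArg (fun φ => φ.hom) hw).trans (Category.assoc _ _ _)
  replace h₁ : F.map ca.hom ≫ aA.hom = F.map cb.hom ≫ bA.hom := congrArg (fun φ => φ.hom) h₁
  replace h₂ : aA.hom ≫ An.hom = F.map am.hom ≫ mn.hom := congrArg (fun φ => φ.hom) h₂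
  replace h₃ : bA.hom ≫ An.hom = F.map bd.hom ≫ F.map dm.hom ≫ mn.hom :=
    congrArg (fun φ => φ.hom) h₃
  obtain ⟨Y, j, hj, ya, hya⟩ :
      ∃ (Y : C) (j : F.obj Y ⟶ A.obj) (_ : IsLocalCoreflection F j) (x : a.obj ⟶ Y),
        F.map x ≫ j = aA.hom := hF.exists_localCoreflection _
  obtain ⟨yb, hyb, hyab⟩ := hj.lift_comp (ca.hom ≫ ya) cb.hom bA.hom
    (by rw [F.map_comp, Category.assoc, hya, h₁])
  obtain ⟨X, e, he, xm, hxm⟩ :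
      ∃ (X : C) (e : F.obj X ⟶ N.obj) (_ : IsLocalCoreflection F e) (x : m.obj ⟶ X),
        F.map x ≫ e = mn.hom := hF.exists_localCoreflection _
  obtain ⟨yx, hyx, hax⟩ := he.lift_comp (am.hom ≫ xm) ya (j ≫ An.hom)
    (by
      rw [F.map_comp, Category.assoc, hxm, reassoc_of% hya]
      exact h₂.symm)
  have hbx : bd.hom ≫ dm.hom ≫ xm = yb ≫ yx := he.ext (by
    simp only [F.map_comp, Category.assoc, hxm, hyx]
    rw [reassoc_of% hyb]
    exact h₃.symm)
  obtain ⟨P, pa, pb, q, hP, hpa, hpb, hext, hdesc⟩ :=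
    hC.exists_localPushout ca.hom cb.hom am.hom (bd.hom ≫ dm.hom) hw'
  obtain ⟨k, hka, hkb⟩ := hdesc ya yb yx xm hyab.symm hax.symm
    ((Category.assoc _ _ _).trans hbx)
  -- The coreflections `Y` of `A` and `X` of `N` move this comparison into `C`, where the legs of
  -- the local pushout are jointly epimorphic.
  have hqk : q ≫ xm = k ≫ yx := hext
    (by rw [reassoc_of% hpa, reassoc_of% hka, hax]) (by rw [reassoc_of% hpb, reassoc_of% hkb, hbx])
  obtain ⟨I, ε, μ, hε, hμ, rfl⟩ := hPre.factors q
  -- The fill-in of `F ε` in `E` against `An` in `M` embeds `F I` in `A` over `N`.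
  obtain ⟨l, ⟨hl₁, hl₂⟩, -⟩ := hEM.lifts (F.map ε) An.hom (F.map k ≫ j) (F.map μ ≫ mn.hom) hε
    An.property (by
      rw [Category.assoc, ← hyx, ← F.map_comp_assoc, ← hqk, ← hxm]
      simp only [F.map_comp, Category.assoc])
  have hMl : M l := hcancel l An.hom (by
    rw [hl₂]
    exact M.comp_mem _ _ hμ mn.property)
  have hMa : M (F.map (pa ≫ ε)) := hcancel _ (F.map μ) (by
    rw [← F.map_comp, Category.assoc, hpa]
    exact am.property)
  have hMb : M (F.map (pb ≫ ε)) := hcancel _ (F.map μ) (by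
    rw [← F.map_comp, Category.assoc, hpb]
    exact (bd ≫ dm).property)
  let I' : WideSubcategory (M.inverseImage F) := ⟨I⟩
  let aI : a ⟶ I' := ⟨pa ≫ ε, hMa⟩
  let bI : b ⟶ I' := ⟨pb ≫ ε, hMb⟩
  let Im : I' ⟶ m := ⟨μ, hμ⟩
  let L : F'.obj I' ⟶ A := ⟨l, hMl⟩
  have haIm : aI ≫ Im = am := WideSubcategory.hom_ext _ ((Category.assoc _ _ _).trans hpa)
  have hbIm : bI ≫ Im = bd ≫ dm := WideSubcategory.hom_ext _ ((Category.assoc _ _ _).trans hpb)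
  have hbL : F'.map bI ≫ L = bA := WideSubcategory.hom_ext _ (by
    change F.map (pb ≫ ε) ≫ l = bA.hom
    rw [F.map_comp, Category.assoc, hl₁, ← F.map_comp_assoc, hkb, hyb])
  have hLn : L ≫ An = F'.map Im ≫ mn := WideSubcategory.hom_ext _ hl₂
  refine ⟨I', m, aI, bI, Im, 𝟙 m, WideSubcategory.hom_ext _ ?_, ?_, ?_, ?_, ?_⟩
  · change ca.hom ≫ pa ≫ ε = cb.hom ≫ pb ≫ ε
    rw [reassoc_of% hP]
  · rw [haIm, Category.comp_id]
  · rw [hbIm, Category.comp_id]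
  · rw [hbIm, Category.comp_id]
  -- Shrink `A` to `F I` by monotonicity on the other side of the square, then remove `mn` by
  -- invariance.
  · rw [← hbL] at hN
    have hN' := hmon _ _ _ _ _ ((hsym _ _ _ _).1 hN)
    rw [hLn] at hN'
    rw [Category.comp_id]
    refine (hinv _ _ _ _ mn ?_).2 ((hsym _ _ _ _).1 hN')
    rw [← F'.map_comp, ← F'.map_comp, hbIm]

end

end IndependenceRelation

namespace IndependenceRelation

/-! ### Accessibility and directed colimits of the category of independent squares -/

theorem squares_lift_iff {X : Type u₁} [Category.{v₁} X] {Y : Type u₂} [Category.{v₂} Y]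
    (G : X ⥤ Y) {R : IndependenceRelation Y} {f g : Arrow X} (φ : f ⟶ g) :
    (R.lift G).squares φ ↔ R.squares (G.mapArrow.map φ) :=
  ⟨fun h => h.2, fun h => ⟨(Arrow.w φ).symm, h⟩⟩

section

variable {X : Type u₁} [Category.{v₁} X] {Y : Type u₂} [Category.{v₂} Y]
  [HasFilteredColimitsOfSize.{w, w} X]
  (G : X ⥤ Y) [PreservesFilteredColimitsOfSize.{w, w} G] {R : IndependenceRelation Y}
  (h₁ : R.BasicExistence) (h₂ : R.Transitivity)
  (h₁' : (R.lift G).BasicExistence) (h₂' : (R.lift G).Transitivity)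

include h₁ h₂

/-- Independent squares of the lift form the preimage of those of `R` under `G.mapArrow`, which
preserves filtered colimits. Hence the results on pulled-back wide subcategories apply. -/
theorem Union.lift (h : Union.{w} R h₁ h₂) : Union.{w} (R.lift G) h₁' h₂' := by
  have := isMultiplicative_squares h₁ h₂
  have := isMultiplicative_squares h₁' h₂'
  have := h.1.hasFilteredColimits
  have := h.2.preservesFilteredColimits
  have := preservesFilteredColimits_mapArrow.{w} G
  have hW {f g : Arrow Y} (φ : f ⟶ g) [IsIso φ] : R.squares φ := squares_of_isIso h₁ φ
  have := wide_pullback_hasFilteredColimits.{w} (squares_lift_iff (R := R) G) hW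
  have := wide_pullback_preservesFilteredColimits.{w} (squares_lift_iff (R := R) G) hW
  exact ⟨hasDirectedColimits_of_hasFilteredColimits _,
    preservesDirectedColimits_of_preservesFilteredColimits _⟩

theorem Accessible.lift [AllMono X] [AllMono Y] [IsAccessibleCategory.{w} X]
    [IsAccessibleCategory.{w} Y] [HasFilteredColimitsOfSize.{w, w} Y] (hmon : R.Monotonicity) (hinv : R.Invariance) (h : Union.{w} R h₁ h₂)
    (hacc : Accessible.{w} R h₁ h₂) : Accessible.{w} (R.lift G) h₁' h₂' := by
  have := isMultiplicative_squares h₁ h₂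
  have := isMultiplicative_squares h₁' h₂'
  have := h.1.hasFilteredColimits
  have := h.2.preservesFilteredColimits
  have := preservesFilteredColimits_mapArrow.{w} G
  have hW {f g : Arrow Y} (φ : f ⟶ g) [IsIso φ] : R.squares φ := squares_of_isIso h₁ φ
  obtain ⟨κ, _, _⟩ := IsAccessibleCategory.exists_cardinal.{w} X
  obtain ⟨κ', _, _⟩ := IsAccessibleCategory.exists_cardinal.{w} Y
  have : IsAccessibleCategory.{w} (Arrow X) :=
    ⟨κ, inferInstance, AllMono.arrow_isCardinalAccessible κ⟩
  have : IsAccessibleCategory.{w} (Arrow Y) :=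
    ⟨κ', inferInstance, AllMono.arrow_isCardinalAccessible κ'⟩
  have : IsAccessibleCategory.{w} (WideSubcategory R.squares) := hacc
  exact wide_pullback_isAccessible.{w} (squares_lift_iff (R := R) G) hW
    (fun _ => inferInstance) (squares_of_comp hmon hinv)

end

/-! ### Assembly of the axioms -/

theorem IsSimple.lift_restrictFunctor {C : Type u₁} [Category.{v₁} C] {D : Type u₂} [Category.{v₂} D]
    (hC : IsLocallyMultipresentable.{w} C)
    (hD : IsLocallyMultipresentable.{w} D)
    (F : C ⥤ D) [F.Faithful] (hF : IsLeftMultiadjoint.{w} F)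
    (E M : MorphismProperty D) [M.IsMultiplicative]
    (hEM : IsFactorisationSystem E M)
    (hMono : M ≤ MorphismProperty.monomorphisms D)
    (hAcc : IsAccessibleClass.{w} M)
    (hPre : IsFactorisationSystem (E.inverseImage F) (M.inverseImage F))
    (R : IndependenceRelation (WideSubcategory M))
    (hR : IsSimple.{w} R)
    (hSemi : R.toAmbient.SemiInvariance) :
    IsSimple.{w} (R.lift (restrictFunctor F M)) := by
  have h₁ : R.BasicExistence := Existence.basicExistence hR.existence hR.invariance
  have hcancel := @SemiInvariance.left_cancel _ _ _ _ _ hSemi h₁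
  have := hC.accessible
  have := hD.accessible
  have : IsAccessibleCategory.{w} (WideSubcategory M) := hAcc
  -- Directed colimits in `D_M` come from those of independent squares, via identity arrows.
  have := (hR.union.hasDirectedColimits h₁ hR.transitivity).hasFilteredColimits
  have := restrict_hasFilteredColimits hC.multicocomplete hF hMono hcancel
  have := restrict_preservesFilteredColimits hC.multicocomplete hF hMono hcancel
  have := restrict_isAccessible hF hEM hMono hcancel hPre hC.multicocomplete
  have := WideSubcategory.allMono M hMono
  have := WideSubcategory.allMono _ (inverseImage_le_monomorphisms (F := F) hMono)
  exact
    { invariance := Invariance.lift _ hR.invariance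
      monotonicity := Monotonicity.lift _ hR.monotonicity
      transitivity := Transitivity.lift _ hR.transitivity
      symmetry := Symmetry.lift _ hR.symmetry
      existence := Existence.lift_restrictFunctor hF hSemi h₁ hR.existence
      threeAmalgamation :=
        ThreeAmalgamation.lift_restrictFunctor hF hSemi h₁ hR.threeAmalgamation
      accessible := Accessible.lift _ h₁ hR.transitivity _ _ hR.monotonicity hR.invariance
        hR.union hR.accessible
      union := Union.lift _ h₁ hR.transitivity _ _ hR.union
      baseMonotonicity := BaseMonotonicity.lift_restrictFunctor hF hEM hPre hcancel
        hC.multicocomplete hR.invariance hR.monotonicity hR.symmetry hR.baseMonotonicity }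

end IndependenceRelation

end CatIndep

theorem mainTheorem3 {C : Type u₁} [Category.{v₁} C] {D : Type u₂} [Category.{v₂} D]
    (hC : CatIndep.IsLocallyMultipresentable.{w} C)
    (hD : CatIndep.IsLocallyMultipresentable.{w} D)
    (F : C ⥤ D) (hFaithful : F.Faithful) (hF : CatIndep.IsLeftMultiadjoint.{w} F)
    (E M : MorphismProperty D) [M.IsMultiplicative]
    (hEM : CatIndep.IsFactorisationSystem E M)
    (hMono : M ≤ MorphismProperty.monomorphisms D)
    (hAcc : CatIndep.IsAccessibleClass.{w} M)
    (hCont : CatIndep.IsContinuousClass.{w} M)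
    (hPre : CatIndep.IsFactorisationSystem (E.inverseImage F) (M.inverseImage F))
    (R : CatIndep.IndependenceRelation (WideSubcategory M))
    (hR : CatIndep.IndependenceRelation.IsSimple.{w} R)
    (hSemi : R.toAmbient.SemiInvariance) :
    CatIndep.IndependenceRelation.IsSimple.{w} (R.lift (CatIndep.restrictFunctor F M)) :=
  CatIndep.IndependenceRelation.IsSimple.lift_restrictFunctor hC hD F hF E M hEM hMono hAcc hPre R
    hR hSemi
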